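/- Let $n\ge 1$ and let $w=w_1\cdots w_n$ be a standard word, i.e. a permutation of $1,\dots,n$. \emph{Catabolizability.} Let $P(u)$ denote the (Schensted row) insertion tableau of a word $u$ with distinct letters, in English notation. For a tableau $T$ with distinct entries whose first row has length at least $m$, let $\mathrm{Cat}_m(T)=P(xy)$, where $x$ is what remains of the first row of $T$ after its first $m$ entries are deleted and $y$ is the row reading word (rows read from bottom to top, each from left to right) of the remaining rows of $T$. For a partition $\lambda=(\lambda_1,\widehat\lambda)$ of the number of cells of $T$, call $T$ \emph{$\lambda$-catabolizable} if the first row of $T$ has at least $\lambda_1$ entries, its first $\lambda_1$ entries are the $\lambda_1$ smallest entries of $T$, and $\mathrm{Cat}_{\lambda_1}(T)$ is $\widehat\lambda$-catabolizable; the empty tableau is $\varnothing$-catabolizable. Let $\mathrm{ctype}(w)$ be the greatest partition $\lambda$ of $n$ in dominance order such that $P(w)$ is $\lambda$-catabolizable. \emph{Chains.} The cocharge labeling $z=z_1\cdots z_n$ of $w$ is obtained by labeling the letter $1$ of $w$ with $0$ and, if the letter $i$ has label $a$, labeling the letter $i+1$ with $a$ if it appears to the right of $i$ in $w$ and with $a+1$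 if it appears to the left. Define $\tilde w:\mathbb Z_{\le n}\to\mathbb Z_{\ge 0}$ by $\tilde w(i)=z_{i+kn}+k$, where $k$ is the unique integer with $1\le i+kn\le n$. A \emph{chain} of $\tilde w$ of length $k'+1$ (with $k'\ge 0$) is a sequence $(j_{k'},\dots,j_1,j_0)$ in $\mathbb Z_{\le n}$ with $j_{k'}<\cdots<j_1<j_0$, with $\tilde w(j_i)=i$ for all $i$, and with $j_0,\dots,j_{k'}$ pairwise incongruent modulo $n$. A \emph{$k$-bounded chain family} is a finite set of chains of $\tilde w$, each of length at most $k$, such that the sets of residues modulo $n$ of distinct chains of the family are disjoint; its \emph{size} is the cardinality of the union of the underlying sets of its chains. Let $I_k(\tilde w)$ be the maximum size of a $k$-bounded chain family of $\tilde w$. \textbf{Theorem.} For every standard word $w$ of length $n\ge1$ the partition $\mathrm{ctype}(w)$ exists, and for every integer $k\ge 0$ \[ \sum_{i=1}^{k}\mathrm{ctype}(w)_i = I_k(\tilde w), \] where $\mathrm{ctype}(w)_i$ is the $i$-th part of $\mathrm{ctype}(w)$ (and $0$ beyond the last part). -/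

import Mathlib

namespace Catabolism

/-! Standard words and cocharge labelings.

A standard word of length `n` is a permutation of `1, …, n`.  It is given by `w : Equiv.Perm (Fin n)`,
where `w p` is the letter at position `p`, with positions and letters counted from `0`. -/

/-- The word `w` written out as a list of the letters `1, …, n`. -/
def toWord {n : ℕ} (w : Equiv.Perm (Fin n)) : List ℕ :=
  List.ofFn fun p => (w p : ℕ) + 1

/-- The cocharge label of a letter: the smallest letter is labeled `0`, and the letter `v + 1` has
the label of `v`, plus one if `v + 1` appears to the left of `v`. -/
def letterLabel {n : ℕ} (w : Equiv.Perm (Fin n)) : (v : ℕ) → v < n → ℕ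
  | 0, _ => 0
  | v + 1, h =>
      letterLabel w v (Nat.lt_of_succ_lt h) +
        if w.symm ⟨v + 1, h⟩ < w.symm ⟨v, Nat.lt_of_succ_lt h⟩ then 1 else 0

/-- The cocharge labeling `z` of `w`: `z p` is the label of the letter at position `p`. -/
def cochargeLabeling {n : ℕ} (w : Equiv.Perm (Fin n)) (p : Fin n) : ℕ :=
  letterLabel w (w p) (w p).isLt

/-! Tableaux (English notation) as lists of rows, from north to south, and Schensted insertion. -/

/-- Row insertion of `x` into a row: `x` replaces the leftmost entry greater than `x`, which is
bumped out; if there is none, `x` is appended and nothing is bumped. -/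
def rowInsert (x : ℕ) : List ℕ → List ℕ × Option ℕ
  | [] => ([x], none)
  | y :: ys => if x < y then (x :: ys, some y) else (y :: (rowInsert x ys).1, (rowInsert x ys).2)

/-- Schensted row insertion of `x` into a tableau. -/
def insertInto : List (List ℕ) → ℕ → List (List ℕ)
  | [], x => [[x]]
  | r :: rs, x =>
    match rowInsert x r with
    | (r', none) => r' :: rs
    | (r', some y) => r' :: insertInto rs y

/-- The insertion tableau `P` of a word. -/
def insertionTableau (u : List ℕ) : List (List ℕ) :=
  u.foldl insertInto []

/-- The row reading word of a (possibly skew) tableau: the rows are read from south to north, each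
one from west to east. -/
def rowword (T : List (List ℕ)) : List ℕ :=
  T.reverse.flatten

/-- The `m`-catabolism of `T`: delete the first `m` entries of the first row, and insert the word of
what is left of the first row followed by the row reading word of the rows below it. -/
def cat (m : ℕ) : List (List ℕ) → List (List ℕ)
  | [] => []
  | r :: rs => insertionTableau (r.drop m ++ rowword rs)

/-- The first row of `T` has at least `m` entries, and its first `m` entries are the `m` smallest
entries of `T` (for tableaux with distinct entries). -/
def HasSmallestInFirstRow (m : ℕ) : List (List ℕ) → Prop
  | [] => m = 0
  | r :: rs => m ≤ r.length ∧ ∀ x ∈ r.take m, ∀ y ∈ r.drop m ++ rs.flatten, x < y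

/-- Catabolizability of a tableau with respect to the list of parts of a partition. -/
def CatabolizableList : List (List ℕ) → List ℕ → Prop
  | T, [] => T = []
  | T, m :: μ => HasSmallestInFirstRow m T ∧ CatabolizableList (cat m T) μ

/-- The parts of a partition in weakly decreasing order. -/
def sortedParts {n : ℕ} (lam : n.Partition) : List ℕ :=
  lam.parts.sort (· ≥ ·)

/-- The sum of the first `k` parts `lam_1 + ⋯ + lam_k` (parts beyond the last being `0`). -/
def partialSum {n : ℕ} (lam : n.Partition) (k : ℕ) : ℕ :=
  ((sortedParts lam).take k).sum

/-- Dominance order: `Dominates lam mu` is `lam ⊵ mu`. -/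
def Dominates {n : ℕ} (lam mu : n.Partition) : Prop :=
  ∀ k : ℕ, partialSum mu k ≤ partialSum lam k

/-- `T` is `lam`-catabolizable. -/
def IsCatabolizable {n : ℕ} (T : List (List ℕ)) (lam : n.Partition) : Prop :=
  CatabolizableList T (sortedParts lam)

/-- `lam` is the greatest partition, in dominance order, for which `T` is `lam`-catabolizable. -/
def IsCtype {n : ℕ} (T : List (List ℕ)) (lam : n.Partition) : Prop :=
  IsCatabolizable T lam ∧ ∀ mu : n.Partition, IsCatabolizable T mu → Dominates lam mu

/-- The catabolizability `ctype(w) = ctype(P(w))` of a standard word: the partition that satisfies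
`IsCtype (insertionTableau (toWord w))`. -/
noncomputable def ctype {n : ℕ} (w : Equiv.Perm (Fin n)) : n.Partition :=
  Classical.epsilon fun lam => IsCtype (insertionTableau (toWord w)) lam

/-! The periodic extension of the cocharge labeling, its chains and chain families. -/

theorem emod_toNat_lt {n : ℕ} [NeZero n] (i : ℤ) : (i % (n : ℤ)).toNat < n := by
  have hn : (0 : ℤ) < n := by exact_mod_cast Nat.pos_of_ne_zero (NeZero.ne n)
  have h1 := Int.emod_lt_of_pos i hn
  have h2 := Int.emod_nonneg i hn.ne'
  omega

/-- The periodic extension `ℤ_{≤ n} → ℤ_{≥ 0}` of the cocharge labeling `z`: it sends `i` to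
`z_{i + k n} + k`, where `k` is the integer with `1 ≤ i + k n ≤ n`
(see `periodicExt_eq`; the position `i + k n` is counted from `0` in `z`). -/
def periodicExt {n : ℕ} [NeZero n] (w : Equiv.Perm (Fin n)) (i : Set.Iic (n : ℤ)) : ℕ :=
  cochargeLabeling w ⟨(((i : ℤ) - 1) % (n : ℤ)).toNat, emod_toNat_lt _⟩ +
    (-(((i : ℤ) - 1) / (n : ℤ))).toNat

theorem periodicExt_eq {n : ℕ} [NeZero n] (w : Equiv.Perm (Fin n)) (i : Set.Iic (n : ℤ))
    (k : ℕ) (p : Fin n) (h : (i : ℤ) + k * n = (p : ℕ) + 1) :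
    periodicExt w i = cochargeLabeling w p + k := by
  have hn : (0 : ℤ) < n := by exact_mod_cast Nat.pos_of_ne_zero (NeZero.ne n)
  have hi : (i : ℤ) - 1 = (p : ℕ) + (-(k : ℤ)) * n := by linarith
  have hp : ((p : ℕ) : ℤ) < n := by exact_mod_cast p.isLt
  have h1 : ((i : ℤ) - 1) % (n : ℤ) = (p : ℕ) := by
    rw [hi, Int.add_mul_emod_self_right, Int.emod_eq_of_lt (by positivity) hp]
  have h2 : ((i : ℤ) - 1) / (n : ℤ) = -(k : ℤ) := by
    rw [hi, Int.add_mul_ediv_right _ _ hn.ne', Int.ediv_eq_zero_of_lt (by positivity) hp, zero_add]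
  simp [periodicExt, h1, h2]

/-- The residue class modulo `n`. -/
def rsd {n : ℕ} (i : Set.Iic (n : ℤ)) : ZMod n := ((i : ℤ) : ZMod n)

/-- A chain `(j_{k'}, …, j_0)` of the periodic extension, with `j_i = idx i` and `k' = top`:
`j_{k'} < ⋯ < j_0`, the value at `j_i` is `i`, and the `j_i` have distinct residues modulo `n`. -/
structure Chain {n : ℕ} [NeZero n] (w : Equiv.Perm (Fin n)) where
  top : ℕ
  idx : Fin (top + 1) → Set.Iic (n : ℤ)
  strictAnti : StrictAnti idx
  value_eq : ∀ i, periodicExt w (idx i) = (i : ℕ)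
  rsd_ne : ∀ i i', i ≠ i' → rsd (idx i) ≠ rsd (idx i')

namespace Chain

variable {n : ℕ} [NeZero n] {w : Equiv.Perm (Fin n)}

/-- The length `k' + 1` of a chain. -/
def length (A : Chain w) : ℕ := A.top + 1

/-- The underlying set of a chain. -/
def underlying (A : Chain w) : Finset (Set.Iic (n : ℤ)) := Finset.univ.image A.idx

/-- The set of residues modulo `n` of a chain. -/
def residues (A : Chain w) : Finset (ZMod n) := A.underlying.image rsd

end Chain

/-- A `k`-bounded chain family: a finite set of chains of lengths at most `k` whose residue sets
are pairwise disjoint. -/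
def IsBoundedChainFamily {n : ℕ} [NeZero n] {w : Equiv.Perm (Fin n)} (k : ℕ)
    (F : Finset (Chain w)) : Prop :=
  (∀ A ∈ F, A.length ≤ k) ∧ ∀ A ∈ F, ∀ B ∈ F, A ≠ B → Disjoint A.residues B.residues

/-- The support of a chain family: the union of the underlying sets of its chains. -/
def support {n : ℕ} [NeZero n] {w : Equiv.Perm (Fin n)} (F : Finset (Chain w)) :
    Finset (Set.Iic (n : ℤ)) :=
  F.biUnion Chain.underlying

/-- The sizes of the `k`-bounded chain families of the periodic extension. -/
def familySizes {n : ℕ} [NeZero n] (w : Equiv.Perm (Fin n)) (k : ℕ) : Set ℕ :=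
  {s | ∃ F : Finset (Chain w), IsBoundedChainFamily k F ∧ (support F).card = s}

/-- `I_k`, the maximum size of a `k`-bounded chain family
(it is attained, see `isGreatest_maxFamilySize`). -/
noncomputable def maxFamilySize {n : ℕ} [NeZero n] (w : Equiv.Perm (Fin n)) (k : ℕ) : ℕ :=
  sSup (familySizes w k)

theorem card_support_le {n : ℕ} [NeZero n] {w : Equiv.Perm (Fin n)} {k : ℕ}
    {F : Finset (Chain w)} (hF : IsBoundedChainFamily k F) : (support F).card ≤ n := by
  have hinj : Set.InjOn (rsd (n := n)) (support F : Set (Set.Iic (n : ℤ))) := by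
    intro x hx y hy hxy
    simp only [support, Finset.mem_coe, Finset.mem_biUnion] at hx hy
    obtain ⟨A, hA, hxA⟩ := hx
    obtain ⟨B, hB, hyB⟩ := hy
    by_cases hAB : A = B
    · subst hAB
      simp only [Chain.underlying, Finset.mem_image, Finset.mem_univ, true_and] at hxA hyB
      obtain ⟨i, rfl⟩ := hxA
      obtain ⟨i', rfl⟩ := hyB
      by_contra hne
      exact A.rsd_ne i i' (fun h => hne (by rw [h])) hxy
    · have h := Finset.disjoint_left.mp (hF.2 A hA B hB hAB)
      exact absurd (hxy ▸ Finset.mem_image_of_mem rsd hyB)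
        (h (Finset.mem_image_of_mem rsd hxA))
  calc (support F).card = ((support F).image rsd).card := (Finset.card_image_of_injOn hinj).symm
    _ ≤ Fintype.card (ZMod n) := Finset.card_le_univ _
    _ = n := ZMod.card n

theorem isGreatest_maxFamilySize {n : ℕ} [NeZero n] (w : Equiv.Perm (Fin n)) (k : ℕ) :
    IsGreatest (familySizes w k) (maxFamilySize w k) := by
  have hne : (familySizes w k).Nonempty :=
    ⟨0, ∅, ⟨by simp, by simp⟩, by simp [support]⟩
  have hb : BddAbove (familySizes w k) := by
    refine ⟨n, ?_⟩
    rintro s ⟨F, hF, rfl⟩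
    exact card_support_le hF
  exact ⟨Nat.sSup_mem hne hb, fun s hs => le_csSup hb hs⟩

end Catabolism

/-! A chain of `w̃` is encoded by its letters. The position of the element of value `i` is
determined by its letter: it lies `i` minus the label periods to the left of the window `1, …, n`.
Being a chain then becomes a condition `Arc` on consecutive letters, together with label 0 at the
head. It remains to bound the sizes of families of disjoint chains of letters. Two facts carry the
proof.

Knuth invariance (`Knuth.exists_isFamily`): Knuth equivalent words have chain families with the same
lists of lengths. Hence a word may be replaced by the reading word of its insertion tableau.

Rotation (`IsSplit`): let the word be `y A x`, with `A` the smallest letters in increasing order.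
Passing to `x y`, which is what a catabolism does, preserves all arcs among the remaining letters. A
letter may follow one of `A` exactly when its label in `x y` is 0. Prepending the letters of `A` to
the chains of `x y` thus gives chains of `y A x`. If `A` contains all letters of label 0, deleting
`A` conversely shortens every nonempty chain.

By the first direction, every catabolism of type `μ` yields families of size `μ_1 + ⋯ + μ_k`
(`exists_isFamily_of_catabolizable`). By the second, the greedy catabolism, which always removes all
letters of label 0, bounds all families by its own partial sums (`exists_catabolizable`); column
strictness makes its parts weakly decreasing. The greedy type is therefore the greatest one, and its
partial sums are the `I_k`. -/

namespace Catabolism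

/-! Precedence of letters in a word. -/

/-- In the word `u`, the letter `p` occurs to the left of the letter `q`. -/
def Before : List ℕ → ℕ → ℕ → Prop
  | [], _, _ => False
  | x :: l, p, q => (x = p ∧ q ∈ l) ∨ Before l p q

theorem before_append {l₁ l₂ : List ℕ} {p q : ℕ} :
    Before (l₁ ++ l₂) p q ↔ Before l₁ p q ∨ (p ∈ l₁ ∧ q ∈ l₂) ∨ Before l₂ p q := by
  induction l₁ with
  | nil => simp [Before]
  | cons x l ih =>
    simp only [List.cons_append, Before, ih, List.mem_append, List.mem_cons]
    grind

theorem Before.mem_left {u : List ℕ} {p q : ℕ} (h : Before u p q) : p ∈ u := by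
  induction u with
  | nil => exact h.elim
  | cons x l ih => simp only [Before] at h; grind

theorem Before.mem_right {u : List ℕ} {p q : ℕ} (h : Before u p q) : q ∈ u := by
  induction u with
  | nil => exact h.elim
  | cons x l ih => simp only [Before] at h; grind

theorem before_total {u : List ℕ} {p q : ℕ} (hp : p ∈ u) (hq : q ∈ u) (hne : p ≠ q) :
    Before u p q ∨ Before u q p := by
  induction u with
  | nil => simp at hp
  | cons x l ih => simp only [Before]; grind

theorem Before.asymm {u : List ℕ} {p q : ℕ} (hu : u.Nodup) (h : Before u p q) :
    ¬ Before u q p := by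
  induction u with
  | nil => exact h.elim
  | cons x l ih =>
    have h1 := fun h : Before l p q => h.mem_right
    have h2 := fun h : Before l q p => h.mem_right
    simp only [Before] at h ⊢
    grind

theorem Before.trans {u : List ℕ} {p q r : ℕ} (hu : u.Nodup) (h : Before u p q)
    (h' : Before u q r) : Before u p r := by
  induction u with
  | nil => exact h.elim
  | cons x l ih =>
    have h1 := fun h : Before l p q => h.mem_right
    have h2 := fun h : Before l q r => h.mem_right
    simp only [Before] at h h' ⊢
    grind

theorem before_of_pairwise_lt {u : List ℕ} (hu : u.Pairwise (· < ·)) {p q : ℕ} (hp : p ∈ u)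
    (hq : q ∈ u) (hpq : p < q) : Before u p q := by
  induction u with
  | nil => simp at hp
  | cons x l ih => simp only [Before]; grind [List.pairwise_cons]

/-! Words whose letters form an interval, and their cocharge labels. -/

/-- The letters of `u` are `s, …, e - 1`, each occurring once. -/
structure IsWord (s e : ℕ) (u : List ℕ) : Prop where
  nodup : u.Nodup
  mem_iff : ∀ v, v ∈ u ↔ s ≤ v ∧ v < e

theorem IsWord.perm {s e : ℕ} {u u' : List ℕ} (h : IsWord s e u) (p : u.Perm u') :
    IsWord s e u' :=
  ⟨p.nodup_iff.mp h.nodup, fun v => by rw [← p.mem_iff, h.mem_iff]⟩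

open Classical in
/-- The cocharge label of the letter `v` in a word with smallest letter `s`. -/
noncomputable def lab (u : List ℕ) (s : ℕ) : ℕ → ℕ
  | 0 => 0
  -- Every number up to `s` gets 0 by convention, so that the label is a monotone function on all of
  -- `ℕ`.
  | v + 1 => if v < s then 0 else lab u s v + if Before u (v + 1) v then 1 else 0

theorem lab_of_le {u : List ℕ} {s v : ℕ} (h : v ≤ s) : lab u s v = 0 := by
  cases v with
  | zero => rfl
  | succ v => simp [lab, Nat.lt_of_succ_le h]

theorem lab_succ_of_before {u : List ℕ} {s v : ℕ} (h : s ≤ v) (hb : Before u (v + 1) v) :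
    lab u s (v + 1) = lab u s v + 1 := by
  simp [lab, h.not_gt, hb]

theorem lab_succ_of_not_before {u : List ℕ} {s v : ℕ} (h : s ≤ v) (hb : ¬ Before u (v + 1) v) :
    lab u s (v + 1) = lab u s v := by
  simp [lab, h.not_gt, hb]

theorem lab_mono (u : List ℕ) (s : ℕ) : Monotone (lab u s) := by
  refine monotone_nat_of_le_succ fun v => ?_
  rcases Nat.lt_or_ge v s with h | h
  · rw [lab_of_le h.le]; exact Nat.zero_le _
  · simp [lab, h.not_gt]

theorem lab_congr {u u' : List ℕ} (h : ∀ v, Before u (v + 1) v ↔ Before u' (v + 1) v) (s v : ℕ) :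
    lab u s v = lab u' s v := by
  induction v with
  | zero => rfl
  | succ v ih =>
    have hv := h v
    by_cases hb : Before u (v + 1) v
    · simp [lab, ih, hb, hv.1 hb]
    · simp [lab, ih, hb, mt hv.2 hb]

/-- Letters with the same label occur from left to right in increasing order. -/
theorem before_of_lab_eq {s e : ℕ} {u : List ℕ} (hu : IsWord s e u) {p q : ℕ} (hs : s ≤ p)
    (hpq : p < q) (hq : q < e) (h : lab u s p = lab u s q) : Before u p q := by
  induction q, hpq using Nat.le_induction with
  | base =>
    by_contra hb
    simp only [Nat.succ_eq_add_one] at *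
    have hb' := (before_total ((hu.mem_iff p).2 ⟨hs, by omega⟩)
      ((hu.mem_iff (p + 1)).2 ⟨by omega, hq⟩) (by omega)).resolve_left hb
    have := lab_succ_of_before hs hb'
    omega
  | succ q hpq ih =>
    have h1 : lab u s p ≤ lab u s q := lab_mono u s (by omega)
    have h2 : lab u s q ≤ lab u s (q + 1) := lab_mono u s (by omega)
    refine (ih (by omega) (by omega)).trans hu.nodup ?_
    by_contra hb
    have hb' := (before_total ((hu.mem_iff q).2 ⟨by omega, by omega⟩)
      ((hu.mem_iff (q + 1)).2 ⟨by omega, hq⟩) (by omega)).resolve_left hb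
    have := lab_succ_of_before (s := s) (by omega) hb'
    omega

/-! Families of chains, written in terms of letters. -/

/-- The letter `q` may follow the letter `p` in a chain. -/
def Arc (u : List ℕ) (s p q : ℕ) : Prop :=
  -- In the periodic extension the value rises by one from `p` to `q`. In the first case `q` is
  -- therefore taken at least one period further left; in the second both are taken in the same
  -- period and `q` must stand left of `p`.
  lab u s q ≤ lab u s p ∨ (lab u s q = lab u s p + 1 ∧ Before u q p)

/-- A list of disjoint, possibly empty, chains of letters. -/
structure IsFamily (u : List ℕ) (s : ℕ) (F : List (List ℕ)) : Prop where
  chain : ∀ c ∈ F, c.IsChain (Arc u s)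
  head : ∀ c ∈ F, ∀ h ∈ c.head?, lab u s h = 0
  nodup : F.flatten.Nodup
  subset : F.flatten ⊆ u

/-! Knuth equivalence. -/

/-- Knuth equivalence of words. -/
inductive Knuth : List ℕ → List ℕ → Prop
  | refl (u) : Knuth u u
  | symm {u v} : Knuth u v → Knuth v u
  | trans {u v w} : Knuth u v → Knuth v w → Knuth u w
  | bac (xs ys) {a b c} : a < b → b < c →
      Knuth (xs ++ b :: a :: c :: ys) (xs ++ b :: c :: a :: ys)
  | acb (xs ys) {a b c} : a < b → b < c →
      Knuth (xs ++ a :: c :: b :: ys) (xs ++ c :: a :: b :: ys)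

theorem Knuth.perm {u v : List ℕ} (h : Knuth u v) : u.Perm v := by
  induction h with
  | refl => exact .refl _
  | symm _ ih => exact ih.symm
  | trans _ _ ih ih' => exact ih.trans ih'
  | bac xs ys _ _ => exact .append_left _ (.cons _ (.swap _ _ _))
  | acb xs ys _ _ => exact .append_left _ (.swap _ _ _)

theorem Knuth.append_left (l : List ℕ) {u v : List ℕ} (h : Knuth u v) :
    Knuth (l ++ u) (l ++ v) := by
  induction h with
  | refl => exact .refl _
  | symm _ ih => exact ih.symm
  | trans _ _ ih ih' => exact ih.trans ih'
  | bac xs ys h h' => simpa using Knuth.bac (l ++ xs) ys h h'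
  | acb xs ys h h' => simpa using Knuth.acb (l ++ xs) ys h h'

theorem Knuth.append_right (l : List ℕ) {u v : List ℕ} (h : Knuth u v) :
    Knuth (u ++ l) (v ++ l) := by
  induction h with
  | refl => exact .refl _
  | symm _ ih => exact ih.symm
  | trans _ _ ih ih' => exact ih.trans ih'
  | bac xs ys h h' => simpa using Knuth.bac xs (ys ++ l) h h'
  | acb xs ys h h' => simpa using Knuth.acb xs (ys ++ l) h h'

/-! Insertion tableaux. -/

/-- The letter `x` passes each letter of the row in turn; the left neighbour of that letter, which
lies between the two in value, witnesses the Knuth move. -/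
theorem knuth_move_left {y x : ℕ} {ys : List ℕ} (h : (y :: ys).Pairwise (· < ·)) (hx : x < y) :
    Knuth (y :: ys ++ [x]) (y :: x :: ys) := by
  induction ys generalizing y with
  | nil => exact .refl _
  | cons z zs ih =>
    have hyz : y < z := by grind
    have h1 := (ih (y := z) (by grind) (by omega)).append_left [y]
    exact h1.trans (Knuth.bac [] zs hx hyz).symm

theorem rowInsert_none {x : ℕ} {r : List ℕ} (h : (rowInsert x r).2 = none) :
    (rowInsert x r).1 = r ++ [x] := by
  induction r with
  | nil => rfl
  | cons y ys ih =>
    simp only [rowInsert] at h ⊢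
    split_ifs at h ⊢
    simp_all

theorem head_rowInsert (x : ℕ) (r : List ℕ) :
    ∃ f l, (rowInsert x r).1 = f :: l ∧ f ≤ x ∧ (f = x ∨ f ∈ r) := by
  cases r with
  | nil => exact ⟨x, [], rfl, le_rfl, .inl rfl⟩
  | cons y ys =>
    by_cases h : x < y
    · exact ⟨x, ys, by simp [rowInsert, h], le_rfl, .inl rfl⟩
    · exact ⟨y, _, by simp [rowInsert, h]; rfl, by omega, by simp⟩

theorem lt_of_rowInsert_some {x y : ℕ} {r : List ℕ} (h : (rowInsert x r).2 = some y) :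
    x < y ∧ y ∈ r := by
  induction r with
  | nil => simp [rowInsert] at h
  | cons z zs ih =>
    simp only [rowInsert] at h
    split_ifs at h with hz
    · simp_all
    · have := ih h; grind

theorem mem_rowInsert {x v : ℕ} {r : List ℕ} (h : v ∈ (rowInsert x r).1) : v = x ∨ v ∈ r := by
  induction r with
  | nil => simpa [rowInsert] using h
  | cons z zs ih =>
    simp only [rowInsert] at h
    split_ifs at h with hz <;> grind

theorem pairwise_rowInsert {x : ℕ} {r : List ℕ} (hr : r.Pairwise (· < ·)) (hx : x ∉ r) :
    (rowInsert x r).1.Pairwise (· < ·) := by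
  induction r with
  | nil => simp [rowInsert]
  | cons z zs ih =>
    simp only [rowInsert]
    have := fun v => mem_rowInsert (x := x) (v := v) (r := zs)
    split_ifs with hz <;> grind [List.pairwise_cons]

theorem knuth_rowInsert {x y : ℕ} {r : List ℕ} (hr : r.Pairwise (· < ·)) (hx : x ∉ r)
    (h : (rowInsert x r).2 = some y) : Knuth (r ++ [x]) (y :: (rowInsert x r).1) := by
  induction r with
  | nil => simp [rowInsert] at h
  | cons z zs ih =>
    by_cases hz : x < z
    · simp only [rowInsert, hz, if_true, Option.some.injEq] at h ⊢
      subst h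
      exact knuth_move_left hr hz
    · simp only [rowInsert, hz, if_false] at h ⊢
      have h1 := (ih (List.pairwise_cons.mp hr).2 (by grind) h).append_left [z]
      refine h1.trans ?_
      obtain ⟨f, l, hf, hfx, hfm⟩ := head_rowInsert x zs
      have hxy := (lt_of_rowInsert_some h).1
      rw [hf]
      -- The bumped letter `y` passes `z`; the witness is the first letter `f` of the new row, with
      -- `z < f ≤ x < y`.
      exact Knuth.acb [] l (by grind [List.pairwise_cons]) (by omega)

/-- The row `s` fits below the row `r` in a column-strict tableau. -/
def Over : List ℕ → List ℕ → Prop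
  | _, [] => True
  | [], _ :: _ => False
  | a :: r, b :: s => a < b ∧ Over r s

theorem Over.rowInsert_left {r s : List ℕ} (x : ℕ) (h : Over r s) : Over (rowInsert x r).1 s := by
  induction r generalizing s with
  | nil => cases s <;> simp_all [Over]
  | cons a r ih =>
    cases s with
    | nil => simp [Over]
    | cons b s =>
      simp only [rowInsert, Over] at h ⊢
      split_ifs
      · exact ⟨by omega, h.2⟩
      · exact ⟨h.1, ih h.2⟩

theorem Over.rowInsert {r s : List ℕ} {x y : ℕ} (hr : r.Pairwise (· < ·)) (h : Over r s)
    (hy : (rowInsert x r).2 = some y) :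
    Over (Catabolism.rowInsert x r).1 (Catabolism.rowInsert y s).1 := by
  induction r generalizing s with
  | nil => simp [Catabolism.rowInsert] at hy
  | cons a r ih =>
    by_cases hx : x < a
    · simp only [Catabolism.rowInsert, hx, if_true, Option.some.injEq] at hy ⊢
      subst hy
      cases s with
      | nil => simpa [Catabolism.rowInsert, Over] using hx
      | cons b s =>
        simp only [Over] at h
        simp only [Catabolism.rowInsert, h.1, if_true, Over]
        exact ⟨hx, h.2⟩
    · simp only [Catabolism.rowInsert, hx, if_false] at hy ⊢
      have hay : a < y := by have := (lt_of_rowInsert_some hy).2; grind [List.pairwise_cons]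
      cases s with
      | nil => simpa [Catabolism.rowInsert, Over] using hay
      | cons b s =>
        simp only [Over] at h
        simp only [Catabolism.rowInsert]
        split_ifs
        · exact ⟨hay, h.2.rowInsert_left x⟩
        · exact ⟨h.1, ih (by grind) h.2 hy⟩

/-- Rows are increasing and columns are strictly increasing. -/
def IsTableau : List (List ℕ) → Prop
  | [] => True
  | r :: rs => r.Pairwise (· < ·) ∧ Over r (rs.headD []) ∧ IsTableau rs

/-! ### Insertion into tableaux and their reading words. -/

theorem rowword_cons (r : List ℕ) (rs : List (List ℕ)) : rowword (r :: rs) = rowword rs ++ r := by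
  simp [rowword]

theorem mem_rowword {T : List (List ℕ)} {v : ℕ} : v ∈ rowword T ↔ v ∈ T.flatten := by
  simp [rowword]

theorem insertInto_cons (r : List ℕ) (rs : List (List ℕ)) (x : ℕ) :
    insertInto (r :: rs) x = (rowInsert x r).1 :: (match (rowInsert x r).2 with
      | none => rs
      | some y => insertInto rs y) := by
  rcases h : rowInsert x r with ⟨r', _ | y⟩ <;> simp [insertInto, h]

theorem headD_insertInto (T : List (List ℕ)) (x : ℕ) :
    (insertInto T x).headD [] = (rowInsert x (T.headD [])).1 := by
  cases T with
  | nil => rfl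
  | cons r rs => simp [insertInto_cons]

theorem isTableau_insertInto {T : List (List ℕ)} {x : ℕ} (hT : IsTableau T)
    (hx : (rowword T ++ [x]).Nodup) :
    IsTableau (insertInto T x) ∧ Knuth (rowword T ++ [x]) (rowword (insertInto T x)) := by
  induction T generalizing x with
  | nil => exact ⟨by simp [insertInto, IsTableau, Over], .refl _⟩
  | cons r rs ih =>
    obtain ⟨hr, ho, hrs⟩ := hT
    rw [rowword_cons] at hx ⊢
    have hxr : x ∉ r := by grind
    rw [insertInto_cons, rowword_cons]
    rcases h : (rowInsert x r).2 with _ | y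
    · simp only [IsTableau]
      refine ⟨⟨pairwise_rowInsert hr hxr, ho.rowInsert_left x, hrs⟩, ?_⟩
      rw [rowInsert_none h, List.append_assoc]
      exact .refl _
    · have hk := (knuth_rowInsert hr hxr h).append_left (rowword rs)
      rw [← List.append_assoc] at hk
      have hnd := hk.perm.nodup_iff.mp hx
      obtain ⟨h1, h2⟩ := ih hrs (x := y) (by
        rw [← List.singleton_append, ← List.append_assoc] at hnd
        exact (List.nodup_append.mp hnd).1)
      simp only [IsTableau]
      refine ⟨⟨pairwise_rowInsert hr hxr, ?_, h1⟩, ?_⟩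
      · rw [headD_insertInto]
        exact ho.rowInsert hr h
      · refine hk.trans ?_
        simpa using h2.append_right (rowInsert x r).1

theorem isTableau_insertionTableau {u : List ℕ} (hu : u.Nodup) :
    IsTableau (insertionTableau u) ∧ Knuth u (rowword (insertionTableau u)) := by
  induction u using List.reverseRecOn with
  | nil => exact ⟨trivial, .refl _⟩
  | append_singleton l x ih =>
    obtain ⟨h1, h2⟩ := ih (List.nodup_append.mp hu).1
    have hk := h2.append_right [x]
    obtain ⟨h3, h4⟩ := isTableau_insertInto h1 (x := x) (hk.perm.nodup_iff.mp hu)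
    have he : insertionTableau (l ++ [x]) = insertInto (insertionTableau l) x := by
      simp [insertionTableau]
    rw [he]
    exact ⟨h3, hk.trans h4⟩

theorem Over.exists_lt {r s : List ℕ} (h : Over r s) {v : ℕ} (hv : v ∈ s) : ∃ a ∈ r, a < v := by
  induction s generalizing r with
  | nil => simp at hv
  | cons b s ih =>
    cases r with
    | nil => exact h.elim
    | cons a r =>
      rcases List.mem_cons.mp hv with rfl | hv
      · exact ⟨a, by simp, h.1⟩
      · obtain ⟨c, hc, hcv⟩ := ih h.2 hv
        exact ⟨c, by simp [hc], hcv⟩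

theorem IsTableau.exists_lt {r : List ℕ} {rs : List (List ℕ)} (h : IsTableau (r :: rs)) {v : ℕ}
    (hv : v ∈ rs.flatten) : ∃ a ∈ r, a < v := by
  induction rs generalizing r with
  | nil => simp at hv
  | cons r' rs ih =>
    rcases List.mem_append.mp (by simpa using hv : v ∈ r' ++ rs.flatten) with hv | hv
    · exact h.2.1.exists_lt hv
    · obtain ⟨a, ha, hav⟩ := ih h.2.2 hv
      obtain ⟨b, hb, hba⟩ := h.2.1.exists_lt ha
      exact ⟨b, hb, hba.trans hav⟩

/-! Chain families are invariant under Knuth equivalence. -/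

theorem isChain_iff_infix {R : ℕ → ℕ → Prop} {l : List ℕ} :
    l.IsChain R ↔ ∀ p q, [p, q] <:+: l → R p q := by
  rw [List.isChain_iff_forall_rel_of_append_cons_cons]
  constructor
  · rintro h p q ⟨l₁, l₂, rfl⟩
    exact h (by simp; rfl)
  · rintro h p q l₁ l₂ rfl
    exact h p q ⟨l₁, l₂, by simp⟩

/-- Applied to a whole family, this says that a step from `a` to `c` is the only step leaving `a`
and the only one entering `c`. -/
theorem eq_and_eq_of_infix {L : List ℕ} (hL : L.Nodup) {a c p q : ℕ} (h : [a, c] <:+: L)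
    (h' : [p, q] <:+: L) : (a = p ↔ c = q) := by
  obtain ⟨l₁, l₂, rfl⟩ := h
  obtain ⟨m₁, m₂, hm⟩ := h'
  have h1 : (l₁ ++ [a, c] ++ l₂).Nodup := hL
  rw [← hm] at hL
  have hi : ∀ {l₁ l₂ m₁ m₂ : List ℕ} {x : ℕ}, (l₁ ++ x :: l₂).Nodup →
      m₁ ++ x :: m₂ = l₁ ++ x :: l₂ → l₁ = m₁ ∧ l₂ = m₂ := by
    intro l₁ l₂ m₁ m₂ x hx he
    have hx' := he ▸ hx
    have := (List.append_cons_inj_of_notMem (by grind) (by grind)).mp he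
    grind
  constructor
  · rintro rfl
    have := hi (l₁ := l₁) (l₂ := c :: l₂) (m₁ := m₁) (m₂ := q :: m₂) (x := a)
      (by simpa using h1) (by simpa using hm)
    grind
  · rintro rfl
    have := hi (l₁ := l₁ ++ [a]) (l₂ := l₂) (m₁ := m₁ ++ [p]) (m₂ := m₂) (x := c)
      (by simpa using h1) (by simpa using hm)
    simpa using (List.append_inj' this.1 rfl).2

theorem before_swap {xs ys : List ℕ} {a c p q : ℕ} (h : ¬ (p = a ∧ q = c))
    (h' : ¬ (p = c ∧ q = a)) :
    Before (xs ++ c :: a :: ys) p q ↔ Before (xs ++ a :: c :: ys) p q := by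
  simp only [before_append, Before, List.mem_cons]
  grind

/-- Labels depend only on the relative order of consecutive letters, and `b` lies strictly between
`a` and `c`. -/
theorem lab_swap {xs ys : List ℕ} {a b c : ℕ} (hab : a < b) (hbc : b < c) (s : ℕ) :
    lab (xs ++ c :: a :: ys) s = lab (xs ++ a :: c :: ys) s :=
  funext <| lab_congr (fun v => before_swap (by omega) (by omega)) s

/-- Only the two pairs formed by `a` and `c` are affected, and the arc from `c` to `a` always exists
because labels are monotone. -/
theorem arc_swap {xs ys : List ℕ} {a b c s p q : ℕ} (hab : a < b) (hbc : b < c)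
    (h : ¬ (p = a ∧ q = c)) :
    Arc (xs ++ c :: a :: ys) s p q ↔ Arc (xs ++ a :: c :: ys) s p q := by
  by_cases h' : p = c ∧ q = a
  · obtain ⟨rfl, rfl⟩ := h'
    exact iff_of_true (.inl (lab_mono _ _ (by omega))) (.inl (lab_mono _ _ (by omega)))
  · rw [Arc, Arc, before_swap (by tauto) (by tauto), lab_swap hab hbc]

theorem IsFamily.of_arc {u u' : List ℕ} {s : ℕ} {F : List (List ℕ)} (hF : IsFamily u s F)
    (hu : u ⊆ u') (hl : lab u' s = lab u s)
    (h : ∀ c ∈ F, ∀ p q, [p, q] <:+: c → Arc u s p q → Arc u' s p q) : IsFamily u' s F where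
  chain c hc := isChain_iff_infix.2 fun p q hpq =>
    h c hc p q hpq (isChain_iff_infix.1 (hF.chain c hc) p q hpq)
  head := by rw [hl]; exact hF.head
  nodup := hF.nodup
  subset _ hv := hu (hF.subset hv)

/-- Moving `c` to the left of `a` can only create the arc from `a` to `c`, so the same family still
works. -/
theorem IsFamily.of_swap {xs ys : List ℕ} {a b c s : ℕ} {F : List (List ℕ)} (hab : a < b)
    (hbc : b < c) (hF : IsFamily (xs ++ a :: c :: ys) s F) :
    IsFamily (xs ++ c :: a :: ys) s F := by
  refine hF.of_arc (by intro v; simp; tauto) (lab_swap hab hbc s) fun d _ p q _ hA => ?_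
  by_cases h : p = a ∧ q = c
  · obtain ⟨rfl, rfl⟩ := h
    rcases hA with hA | ⟨hA, -⟩
    · exact .inl (by rwa [lab_swap hab hbc])
    · exact .inr ⟨by rwa [lab_swap hab hbc], by simp [before_append, Before]⟩
  · exact (arc_swap hab hbc h).2 hA

theorem IsFamily.map_perm {u u' : List ℕ} {s : ℕ} {F : List (List ℕ)} (hF : IsFamily u s F)
    (σ : Equiv.Perm ℕ) (hu : ∀ v ∈ u, σ v ∈ u') (hl : ∀ v, lab u' s (σ v) = lab u s v)
    (h : ∀ c ∈ F, ∀ p q, [p, q] <:+: c → Arc u s p q → Arc u' s (σ p) (σ q)) :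
    IsFamily u' s (F.map (List.map σ)) where
  chain c hc := by
    obtain ⟨d, hd, rfl⟩ := List.mem_map.mp hc
    rw [List.isChain_map]
    exact isChain_iff_infix.2 fun p q hpq =>
      h d hd p q hpq (isChain_iff_infix.1 (hF.chain d hd) p q hpq)
  head c hc := by
    obtain ⟨d, hd, rfl⟩ := List.mem_map.mp hc
    simp only [List.head?_map, Option.mem_map]
    rintro _ ⟨v, hv, rfl⟩
    rw [hl]
    exact hF.head d hd v hv
  nodup := by
    rw [← List.map_flatten]
    exact hF.nodup.map σ.injective
  subset := by
    rw [← List.map_flatten]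
    intro v hv
    obtain ⟨x, hx, rfl⟩ := List.mem_map.mp hv
    exact hu x (hF.subset hx)

theorem map_length_map (σ : ℕ → ℕ) (F : List (List ℕ)) :
    (F.map (List.map σ)).map List.length = F.map List.length := by
  simp

theorem infix_flatten {l : List ℕ} {F : List (List ℕ)} {c : List ℕ} (hc : c ∈ F) (h : l <:+: c) :
    l <:+: F.flatten := by
  obtain ⟨F₁, F₂, rfl⟩ := List.append_of_mem hc
  exact h.trans ⟨F₁.flatten, F₂.flatten, by simp⟩

/-- The move can only destroy the arc from `a` to `c`. If a chain uses it and it is lost, then `b`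
and `c` have the same label, and exchanging `b` and `c` throughout the family repairs it: the step
becomes `a` to `b`, with `b` still left of `a`. -/
theorem IsFamily.bac {xs ys : List ℕ} {a b c s e : ℕ} {F : List (List ℕ)} (hab : a < b)
    (hbc : b < c) (hu : IsWord s e (xs ++ b :: c :: a :: ys))
    (hF : IsFamily (xs ++ b :: c :: a :: ys) s F) :
    ∃ F', IsFamily (xs ++ b :: a :: c :: ys) s F' ∧ F'.map List.length = F.map List.length := by
  have hl : lab (xs ++ b :: c :: a :: ys) s = lab (xs ++ b :: a :: c :: ys) s := by
    simpa using lab_swap (xs := xs ++ [b]) (ys := ys) hab hbc s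
  have harc : ∀ p q, ¬ (p = a ∧ q = c) → (Arc (xs ++ b :: c :: a :: ys) s p q ↔
      Arc (xs ++ b :: a :: c :: ys) s p q) := fun p q h => by
    simpa using arc_swap (xs := xs ++ [b]) (ys := ys) (s := s) hab hbc h
  by_cases hac : (∃ d ∈ F, [a, c] <:+: d) ∧ ¬ Arc (xs ++ b :: a :: c :: ys) s a c
  · obtain ⟨⟨d, hd, hdi⟩, hn⟩ := hac
    have ha : s ≤ a := ((hu.mem_iff a).1 (by simp)).1
    have hc : c < e := ((hu.mem_iff c).1 (by simp)).2
    have h1 : lab (xs ++ b :: c :: a :: ys) s c = lab (xs ++ b :: c :: a :: ys) s a + 1 := by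
      rcases isChain_iff_infix.1 (hF.chain d hd) a c hdi with h | h
      · exact (hn (.inl (hl ▸ h))).elim
      · exact h.1
    have h2 : lab (xs ++ b :: c :: a :: ys) s a ≤ lab (xs ++ b :: c :: a :: ys) s b :=
      lab_mono _ _ hab.le
    have h3 : lab (xs ++ b :: c :: a :: ys) s b ≤ lab (xs ++ b :: c :: a :: ys) s c :=
      lab_mono _ _ hbc.le
    -- Since `b` stands left of the smaller letter `a`, their labels differ; with the bounds above
    -- this forces `b` to have the label of `c`.
    have h4 : lab (xs ++ b :: c :: a :: ys) s b ≠ lab (xs ++ b :: c :: a :: ys) s a := fun h =>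
      (before_of_lab_eq hu ha hab (hbc.trans hc) h.symm).asymm hu.nodup
        (by simp [before_append, Before])
    refine ⟨_, hF.map_perm (Equiv.swap b c) ?_ ?_ ?_, map_length_map _ _⟩
    · intro v hv
      rw [Equiv.swap_apply_def]
      grind
    · intro v
      rw [Equiv.swap_apply_def, ← hl]
      grind
    · intro d' hd' p q hpq hA
      -- No other step leaves `a` or enters `c`; for the remaining steps, `b` and `c` are separated
      -- at most by `a` and hence interchangeable.
      have hun := eq_and_eq_of_infix hF.nodup (infix_flatten hd hdi) (infix_flatten hd' hpq)
      have hnd := hu.nodup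
      have hxs : ∀ p q, Before xs p q → p ∈ xs ∧ q ∈ xs := fun p q h => ⟨h.mem_left, h.mem_right⟩
      have hys : ∀ p q, Before ys p q → p ∈ ys ∧ q ∈ ys := fun p q h => ⟨h.mem_left, h.mem_right⟩
      have ma : a ∉ xs ∧ a ∉ ys := by grind
      have mb : b ∉ xs ∧ b ∉ ys := by grind
      have mc : c ∉ xs ∧ c ∉ ys := by grind
      clear hnd hF hu harc
      revert h1 h2 h3 h4 hA
      rw [Equiv.swap_apply_def, Equiv.swap_apply_def, Arc, Arc, ← hl]
      generalize lab (xs ++ b :: c :: a :: ys) s = f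
      intro h1 h2 h3 h4 hA
      simp only [before_append, Before, List.mem_cons] at hA ⊢
      grind
  · refine ⟨F, hF.of_arc (by intro v; simp; tauto) hl.symm fun d hd p q hpq hA => ?_, rfl⟩
    by_cases h : p = a ∧ q = c
    · obtain ⟨rfl, rfl⟩ := h
      by_contra hn
      exact hac ⟨⟨d, hd, hpq⟩, hn⟩
    · exact (harc p q h).1 hA

/-- Here a lost arc from `a` to `c` forces `a` and `b` to have the same label, and `a` and `b` are
exchanged: the step becomes `b` to `c`, with `c` still left of `b`. -/
theorem IsFamily.acb {xs ys : List ℕ} {a b c s e : ℕ} {F : List (List ℕ)} (hab : a < b)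
    (hbc : b < c) (hu : IsWord s e (xs ++ c :: a :: b :: ys))
    (hF : IsFamily (xs ++ c :: a :: b :: ys) s F) :
    ∃ F', IsFamily (xs ++ a :: c :: b :: ys) s F' ∧ F'.map List.length = F.map List.length := by
  have hl : lab (xs ++ c :: a :: b :: ys) s = lab (xs ++ a :: c :: b :: ys) s :=
    lab_swap hab hbc s
  have harc : ∀ p q, ¬ (p = a ∧ q = c) → (Arc (xs ++ c :: a :: b :: ys) s p q ↔
      Arc (xs ++ a :: c :: b :: ys) s p q) := fun p q h =>
    arc_swap hab hbc h
  by_cases hac : (∃ d ∈ F, [a, c] <:+: d) ∧ ¬ Arc (xs ++ a :: c :: b :: ys) s a c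
  · obtain ⟨⟨d, hd, hdi⟩, hn⟩ := hac
    have ha : s ≤ a := ((hu.mem_iff a).1 (by simp)).1
    have hc : c < e := ((hu.mem_iff c).1 (by simp)).2
    have h1 : lab (xs ++ c :: a :: b :: ys) s c = lab (xs ++ c :: a :: b :: ys) s a + 1 := by
      rcases isChain_iff_infix.1 (hF.chain d hd) a c hdi with h | h
      · exact (hn (.inl (hl ▸ h))).elim
      · exact h.1
    have h2 : lab (xs ++ c :: a :: b :: ys) s a ≤ lab (xs ++ c :: a :: b :: ys) s b :=
      lab_mono _ _ hab.le
    have h3 : lab (xs ++ c :: a :: b :: ys) s b ≤ lab (xs ++ c :: a :: b :: ys) s c :=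
      lab_mono _ _ hbc.le
    have h4 : lab (xs ++ c :: a :: b :: ys) s b ≠ lab (xs ++ c :: a :: b :: ys) s c := fun h =>
      (before_of_lab_eq hu (ha.trans hab.le) hbc hc h).asymm hu.nodup
        (by simp [before_append, Before])
    refine ⟨_, hF.map_perm (Equiv.swap a b) ?_ ?_ ?_, map_length_map _ _⟩
    · intro v hv
      rw [Equiv.swap_apply_def]
      grind
    · intro v
      rw [Equiv.swap_apply_def, ← hl]
      grind
    · intro d' hd' p q hpq hA
      have hun := eq_and_eq_of_infix hF.nodup (infix_flatten hd hdi) (infix_flatten hd' hpq)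
      have hnd := hu.nodup
      have hxs : ∀ p q, Before xs p q → p ∈ xs ∧ q ∈ xs := fun p q h => ⟨h.mem_left, h.mem_right⟩
      have hys : ∀ p q, Before ys p q → p ∈ ys ∧ q ∈ ys := fun p q h => ⟨h.mem_left, h.mem_right⟩
      have ma : a ∉ xs ∧ a ∉ ys := by grind
      have mb : b ∉ xs ∧ b ∉ ys := by grind
      have mc : c ∉ xs ∧ c ∉ ys := by grind
      clear hnd hF hu harc
      revert h1 h2 h3 h4 hA
      rw [Equiv.swap_apply_def, Equiv.swap_apply_def, Arc, Arc, ← hl]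
      generalize lab (xs ++ c :: a :: b :: ys) s = f
      intro h1 h2 h3 h4 hA
      simp only [before_append, Before, List.mem_cons] at hA ⊢
      grind
  · refine ⟨F, hF.of_arc (by intro v; simp; tauto) hl.symm fun d hd p q hpq hA => ?_, rfl⟩
    by_cases h : p = a ∧ q = c
    · obtain ⟨rfl, rfl⟩ := h
      by_contra hn
      exact hac ⟨⟨d, hd, hpq⟩, hn⟩
    · exact (harc p q h).1 hA


theorem Knuth.exists_isFamily {u v : List ℕ} (h : Knuth u v) {s e : ℕ} (hu : IsWord s e u) :
    (∀ F, IsFamily u s F → ∃ F', IsFamily v s F' ∧ F'.map List.length = F.map List.length) ∧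
      ∀ F, IsFamily v s F → ∃ F', IsFamily u s F' ∧ F'.map List.length = F.map List.length := by
  induction h with
  | refl => exact ⟨fun F hF => ⟨F, hF, rfl⟩, fun F hF => ⟨F, hF, rfl⟩⟩
  | symm h ih => exact (ih (hu.perm h.perm.symm)).symm
  | trans h h' ih ih' =>
    obtain ⟨h1, h2⟩ := ih hu
    obtain ⟨h3, h4⟩ := ih' (hu.perm h.perm)
    constructor
    · intro F hF
      obtain ⟨F', hF', he⟩ := h1 F hF
      obtain ⟨F'', hF'', he'⟩ := h3 F' hF'
      exact ⟨F'', hF'', he'.trans he⟩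
    · intro F hF
      obtain ⟨F', hF', he⟩ := h4 F hF
      obtain ⟨F'', hF'', he'⟩ := h2 F' hF'
      exact ⟨F'', hF'', he'.trans he⟩
  | @bac xs ys a b c hab hbc =>
    refine ⟨fun F hF => ⟨F, ?_, rfl⟩, fun F hF =>
      hF.bac hab hbc (hu.perm (Knuth.bac xs ys hab hbc).perm)⟩
    have h := IsFamily.of_swap (xs := xs ++ [b]) (ys := ys) (s := s) (F := F) hab hbc
      (by rw [List.append_assoc]; exact hF)
    rw [List.append_assoc] at h
    exact h
  | acb xs ys hab hbc =>
    exact ⟨fun F hF => ⟨F, hF.of_swap hab hbc, rfl⟩, fun F hF =>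
      hF.acb hab hbc (hu.perm (Knuth.acb xs ys hab hbc).perm)⟩

/-! Removing the smallest letters and rotating. -/

theorem mem_iff_of_smallest {A B : List ℕ} {s e : ℕ} (hA : A.Pairwise (· < ·))
    (hw : IsWord s e (A ++ B)) (hAB : ∀ a ∈ A, ∀ b ∈ B, a < b) (v : ℕ) :
    v ∈ A ↔ s ≤ v ∧ v < s + A.length := by
  induction A generalizing s with
  | nil => simp
  | cons a A ih =>
    have has := (hw.mem_iff a).1 (by simp)
    have hsa := (hw.mem_iff s).2 ⟨le_rfl, by omega⟩
    obtain rfl : a = s := by grind [List.pairwise_cons]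
    have hA' := List.pairwise_cons.mp hA
    have hnd := hw.nodup
    have hw' : IsWord (a + 1) e (A ++ B) := by
      refine ⟨(List.nodup_cons.mp hnd).2, fun v => ?_⟩
      have h1 := hw.mem_iff v
      grind
    rw [List.mem_cons, ih hA'.2 hw' (by grind), List.length_cons]
    omega

/-- The word `y ++ (A ++ x)` whose smallest letters are the letters of `A`, in increasing order. -/
structure IsSplit (s e : ℕ) (y A x : List ℕ) : Prop where
  word : IsWord s e (y ++ (A ++ x))
  pairwise : A.Pairwise (· < ·)
  lt : ∀ a ∈ A, ∀ v ∈ x ++ y, a < v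
  ne_nil : A ≠ []

namespace IsSplit

variable {s e : ℕ} {y A x : List ℕ}

theorem mem_iff (h : IsSplit s e y A x) (v : ℕ) : v ∈ A ↔ s ≤ v ∧ v < s + A.length :=
  mem_iff_of_smallest (B := x ++ y) h.pairwise
    (h.word.perm (by rw [← List.append_assoc A]; exact List.perm_append_comm)) h.lt v

theorem isWord (h : IsSplit s e y A x) : IsWord (s + A.length) e (x ++ y) := by
  have hnd := h.word.nodup
  refine ⟨by grind, fun v => ?_⟩
  have h1 := h.word.mem_iff v
  have h2 := h.mem_iff v
  grind

theorem lab_eq_zero (h : IsSplit s e y A x) {v : ℕ} (hv : v < s + A.length) :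
    lab (y ++ (A ++ x)) s v = 0 := by
  induction v with
  | zero => rfl
  | succ v ih =>
    rcases Nat.lt_or_ge v s with hs | hs
    · exact lab_of_le hs
    · rw [lab_succ_of_not_before hs, ih (by omega)]
      refine Before.asymm h.word.nodup ?_
      have := before_of_pairwise_lt h.pairwise ((h.mem_iff v).2 ⟨by omega, by omega⟩)
        ((h.mem_iff (v + 1)).2 ⟨by omega, by omega⟩) (by omega)
      simp [before_append, this]

/-- Only pairs of consecutive letters split between `x` and `y` change their order under rotation,
and they are compensated by the shift of the labels in `y`. The induction starts at the first letter
beyond `A`, whose label is 1 exactly when it lies in `y`, left of `A`. -/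
theorem lab_eq (h : IsSplit s e y A x) {v : ℕ} (hv : s + A.length ≤ v) (hve : v < e) :
    (v ∈ x → lab (y ++ (A ++ x)) s v = lab (x ++ y) (s + A.length) v) ∧
      (v ∈ y → lab (y ++ (A ++ x)) s v = lab (x ++ y) (s + A.length) v + 1) := by
  have hnd := h.word.nodup
  have hx : ∀ p q, Before x p q → p ∈ x ∧ q ∈ x := fun p q h => ⟨h.mem_left, h.mem_right⟩
  have hy : ∀ p q, Before y p q → p ∈ y ∧ q ∈ y := fun p q h => ⟨h.mem_left, h.mem_right⟩
  have hA : ∀ p q, Before A p q → p ∈ A ∧ q ∈ A := fun p q h => ⟨h.mem_left, h.mem_right⟩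
  have hxy : ∀ v, v ∈ x → v ∉ y := by grind
  have hxA : ∀ v, v ∈ x → v ∉ A := by grind
  have hyA : ∀ v, v ∈ y → v ∉ A := by grind
  induction v, hv using Nat.le_induction with
  | base =>
    obtain ⟨m, hm⟩ := Nat.exists_eq_succ_of_ne_zero
      (mt List.length_eq_zero_iff.mp h.ne_nil)
    have h0 := h.lab_eq_zero (v := s + m) (by omega)
    have hmA := (h.mem_iff (s + m)).2 ⟨by omega, by omega⟩
    rw [lab_of_le (u := x ++ y) le_rfl, hm, Nat.succ_eq_add_one, ← add_assoc]
    constructor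
    · intro hv
      rw [lab_succ_of_not_before (by omega), h0]
      simp only [before_append]
      grind
    · intro hv
      rw [lab_succ_of_before (by omega), h0]
      simp only [before_append]
      grind
  | succ v hv ih =>
    obtain ⟨ihx, ihy⟩ := ih (by omega)
    have hv1 := (h.isWord.mem_iff v).2 ⟨hv, by omega⟩
    rw [List.mem_append] at hv1
    by_cases hb : Before (y ++ (A ++ x)) (v + 1) v <;>
    by_cases hb' : Before (x ++ y) (v + 1) v <;>
    simp only [hb, hb', lab_succ_of_before, lab_succ_of_not_before, hv, not_false_eq_true,
      show s ≤ v by omega] <;>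
    simp only [before_append] at hb hb' <;>
    grind

/-- For letters in different blocks, the change of label by one is offset by the change of relative
order. -/
theorem arc_iff (h : IsSplit s e y A x) {p q : ℕ} (hp : p ∈ x ++ y) (hq : q ∈ x ++ y) :
    Arc (y ++ (A ++ x)) s p q ↔ Arc (x ++ y) (s + A.length) p q := by
  have hnd := h.word.nodup
  have hx : ∀ p q, Before x p q → p ∈ x ∧ q ∈ x := fun p q h => ⟨h.mem_left, h.mem_right⟩
  have hy : ∀ p q, Before y p q → p ∈ y ∧ q ∈ y := fun p q h => ⟨h.mem_left, h.mem_right⟩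
  have hA : ∀ p q, Before A p q → p ∈ A ∧ q ∈ A := fun p q h => ⟨h.mem_left, h.mem_right⟩
  have hxy : ∀ v, v ∈ x → v ∉ y := by grind
  have hxA : ∀ v, v ∈ x → v ∉ A := by grind
  have hyA : ∀ v, v ∈ y → v ∉ A := by grind
  have hp' := (h.isWord.mem_iff p).1 hp
  have hq' := (h.isWord.mem_iff q).1 hq
  have h1 := h.lab_eq hp'.1 hp'.2
  have h2 := h.lab_eq hq'.1 hq'.2
  simp only [Arc, before_append]
  rw [List.mem_append] at hp hq
  grind

/-- A letter of `x` stands right of `A` and needs label 0; a letter of `y` stands left of `A` and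
may have label 1, which rotation lowers to 0. -/
theorem arc_smallest_iff (h : IsSplit s e y A x) {p q : ℕ} (hp : p ∈ A) (hq : q ∈ x ++ y) :
    Arc (y ++ (A ++ x)) s p q ↔ lab (x ++ y) (s + A.length) q = 0 := by
  have hnd := h.word.nodup
  have hx : ∀ p q, Before x p q → p ∈ x ∧ q ∈ x := fun p q h => ⟨h.mem_left, h.mem_right⟩
  have hy : ∀ p q, Before y p q → p ∈ y ∧ q ∈ y := fun p q h => ⟨h.mem_left, h.mem_right⟩
  have hA : ∀ p q, Before A p q → p ∈ A ∧ q ∈ A := fun p q h => ⟨h.mem_left, h.mem_right⟩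
  have hxy : ∀ v, v ∈ x → v ∉ y := by grind
  have hxA : ∀ v, v ∈ x → v ∉ A := by grind
  have hyA : ∀ v, v ∈ y → v ∉ A := by grind
  have hp' := h.lab_eq_zero ((h.mem_iff p).1 hp).2
  have hq' := (h.isWord.mem_iff q).1 hq
  have h2 := h.lab_eq hq'.1 hq'.2
  simp only [Arc, before_append, hp']
  rw [List.mem_append] at hq
  grind

end IsSplit

theorem perm_flatten_zipWith_cons {A : List ℕ} {G : List (List ℕ)} (h : A.length = G.length) :
    (List.zipWith List.cons A G).flatten.Perm (A ++ G.flatten) := by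
  induction A generalizing G with
  | nil => cases G <;> simp_all
  | cons a A ih =>
    cases G with
    | nil => simp at h
    | cons c G =>
      simp only [List.zipWith_cons_cons, List.flatten_cons, List.cons_append]
      refine .cons _ (((ih (by simpa using h)).append_left c).trans ?_)
      simp only [← List.append_assoc]
      exact List.perm_append_comm.append_right _

/-- Chains of the rotated word are prolonged by the smallest letters. -/
theorem IsSplit.exists_isFamily_of_rotate {s e : ℕ} {y A x : List ℕ} (h : IsSplit s e y A x)
    {F : List (List ℕ)} (hF : IsFamily (x ++ y) (s + A.length) F) (hm : F.length ≤ A.length)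
    {k : ℕ} (hk : ∀ c ∈ F, c.length ≤ k) :
    ∃ G, IsFamily (y ++ (A ++ x)) s G ∧ G.length = A.length ∧ (∀ c ∈ G, c.length ≤ k + 1) ∧
      G.flatten.length = A.length + F.flatten.length := by
  -- Padding by empty chains lets each letter of `A` start exactly one chain.
  set E := F ++ List.replicate (A.length - F.length) [] with hE
  have hlen : A.length = E.length := by simp [hE]; omega
  have hflat : E.flatten = F.flatten := by simp [hE]
  have hmem : ∀ c ∈ E, c ∈ F ∨ c = [] := by
    intro c hc
    rcases List.mem_append.mp hc with hc | hc
    · exact .inl hc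
    · exact .inr (List.eq_of_mem_replicate hc)
  have hperm := perm_flatten_zipWith_cons hlen
  rw [hflat] at hperm
  have hz : ∀ d ∈ List.zipWith List.cons A E, ∃ a ∈ A, ∃ c, (c ∈ F ∨ c = []) ∧ d = a :: c := by
    intro d hd
    rw [← List.map_uncurry_zip_eq_zipWith] at hd
    obtain ⟨⟨a, c⟩, hac, rfl⟩ := List.mem_map.mp hd
    exact ⟨a, (List.of_mem_zip hac).1, c, hmem c (List.of_mem_zip hac).2, rfl⟩
  refine ⟨List.zipWith List.cons A E, ⟨?_, ?_, ?_, ?_⟩, by simp [hlen], ?_, ?_⟩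
  · intro d hd
    obtain ⟨a, ha, c, hc, rfl⟩ := hz d hd
    rcases hc with hc | rfl
    · have hcx : ∀ v ∈ c, v ∈ x ++ y := fun v hv => hF.subset (List.mem_flatten.mpr ⟨c, hc, hv⟩)
      have hch := (hF.chain c hc).imp_of_mem_imp (S := Arc (y ++ (A ++ x)) s)
        fun p q hp hq hpq => (h.arc_iff (hcx p hp) (hcx q hq)).2 hpq
      have hhd := hF.head c hc
      cases c with
      | nil => simp
      | cons b c =>
        exact .cons_cons ((h.arc_smallest_iff ha (hcx b (by simp))).2 (hhd b rfl)) hch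
    · simp
  · intro d hd v hv
    obtain ⟨a, ha, c, hc, rfl⟩ := hz d hd
    obtain rfl : a = v := by simpa using hv
    exact h.lab_eq_zero ((h.mem_iff _).1 ha).2
  · rw [hperm.nodup_iff, List.nodup_append]
    refine ⟨by have := h.word.nodup; grind, hF.nodup, fun a ha v hv => ?_⟩
    exact (h.lt a ha v (hF.subset hv)).ne
  · intro v hv
    rcases List.mem_append.mp (hperm.subset hv) with hv | hv
    · simp [hv]
    · have := hF.subset hv
      grind
  · intro d hd
    obtain ⟨a, ha, c, hc, rfl⟩ := hz d hd
    rcases hc with hc | rfl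
    · simpa using hk c hc
    · simp
  · rw [hperm.length_eq, List.length_append]

/-- Deleting letters of `A` inside a chain leaves a chain: the next remaining letter has label 0 in
the rotated word, so it may follow any letter. For the same reason, it may also serve as a head. -/
theorem IsSplit.isChain_filter {s e : ℕ} {y A x : List ℕ} (h : IsSplit s e y A x) {c : List ℕ}
    {p : ℕ} (hc : (p :: c).IsChain (Arc (y ++ (A ++ x)) s)) (hm : p :: c ⊆ y ++ (A ++ x)) :
    (p ∉ A → (p :: c.filter (· ∉ A)).IsChain (Arc (x ++ y) (s + A.length))) ∧
      (p ∈ A → (c.filter (· ∉ A)).IsChain (Arc (x ++ y) (s + A.length)) ∧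
        ∀ v ∈ (c.filter (· ∉ A)).head?, lab (x ++ y) (s + A.length) v = 0) := by
  induction c generalizing p with
  | nil => simp
  | cons q c ih =>
    rw [List.isChain_cons_cons] at hc
    obtain ⟨ih1, ih2⟩ := ih hc.2 (fun v hv => hm (List.mem_cons_of_mem _ hv))
    have hpm : p ∈ y ++ (A ++ x) := hm (by simp)
    have hqm : q ∈ y ++ (A ++ x) := hm (by simp)
    by_cases hq : q ∈ A
    · simp only [hq, not_true_eq_false, decide_false, Bool.false_eq_true, not_false_eq_true,
        List.filter_cons_of_neg]
      obtain ⟨h1, h2⟩ := ih2 hq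
      refine ⟨fun _ => ?_, fun _ => ⟨h1, h2⟩⟩
      revert h1 h2
      generalize c.filter (· ∉ A) = d
      intro h1 h2
      cases d with
      | nil => simp
      | cons b d => exact .cons_cons (.inl (by rw [h2 b rfl]; exact Nat.zero_le _)) h1
    · simp only [hq, not_false_eq_true, decide_true, List.filter_cons_of_pos]
      refine ⟨fun hp => .cons_cons ((h.arc_iff (by grind) (by grind)).1 hc.1) (ih1 hq),
        fun hp => ⟨ih1 hq, ?_⟩⟩
      simpa using (h.arc_smallest_iff hp (by grind)).1 hc.1

/-- If the smallest letters are the letters with label `0`, then deleting them from the chains of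
a word leaves chains of the rotated word. -/
theorem IsSplit.exists_isFamily_rotate {s e : ℕ} {y A x : List ℕ} (h : IsSplit s e y A x)
    (h0 : ∀ v ∈ y ++ (A ++ x), lab (y ++ (A ++ x)) s v = 0 → v ∈ A)
    {F : List (List ℕ)} (hF : IsFamily (y ++ (A ++ x)) s F)
    {k : ℕ} (hk : ∀ c ∈ F, c.length ≤ k + 1) :
    ∃ G, IsFamily (x ++ y) (s + A.length) G ∧ (∀ c ∈ G, c.length ≤ k) ∧
      F.flatten.length ≤ A.length + G.flatten.length := by
  have key : ∀ c ∈ F, c = [] ∨ ∃ p ∈ A, ∃ d, c = p :: d ∧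
      c.filter (· ∉ A) = d.filter (· ∉ A) ∧ c ⊆ y ++ (A ++ x) := by
    intro c hc
    have hs : c ⊆ y ++ (A ++ x) := fun v hv => hF.subset (List.mem_flatten.mpr ⟨c, hc, hv⟩)
    have hh := hF.head c hc
    cases c with
    | nil => exact .inl rfl
    | cons p d =>
      have hp := h0 p (hs (by simp)) (hh p rfl)
      exact .inr ⟨p, hp, d, rfl, by simp [hp], hs⟩
  refine ⟨F.map (List.filter (· ∉ A)), ⟨?_, ?_, ?_, ?_⟩, ?_, ?_⟩
  · intro c hc
    obtain ⟨c, hcF, rfl⟩ := List.mem_map.mp hc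
    rcases key c hcF with rfl | ⟨p, hp, d, rfl, hd, hs⟩
    · simp
    · rw [hd]
      exact ((h.isChain_filter (hF.chain _ hcF) hs).2 hp).1
  · intro c hc
    obtain ⟨c, hcF, rfl⟩ := List.mem_map.mp hc
    rcases key c hcF with rfl | ⟨p, hp, d, rfl, hd, hs⟩
    · simp
    · rw [hd]
      exact ((h.isChain_filter (hF.chain _ hcF) hs).2 hp).2
  · rw [← List.filter_flatten]
    exact hF.nodup.filter _
  · rw [← List.filter_flatten]
    intro v hv
    have hv1 := List.mem_filter.mp hv
    have hv2 := hF.subset hv1.1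
    grind
  · intro c hc
    obtain ⟨c, hcF, rfl⟩ := List.mem_map.mp hc
    rcases key c hcF with rfl | ⟨p, hp, d, rfl, hd, hs⟩
    · simp
    · rw [hd]
      -- The head of each nonempty chain lies in `A` and is deleted, which lowers the length bound
      -- by one.
      have := hk _ hcF
      have := List.length_filter_le (· ∉ A) d
      grind
  · rw [← List.filter_flatten, List.length_eq_length_filter_add (l := F.flatten) (· ∈ A)]
    have h1 : (F.flatten.filter (· ∈ A)).length ≤ A.length :=
      (hF.nodup.filter _).subperm (fun v hv => by simpa using (List.mem_filter.mp hv).2)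
        |>.length_le
    have h2 : F.flatten.filter (fun v => !decide (v ∈ A)) = F.flatten.filter (· ∉ A) := by
      congr 1; funext v; simp
    rw [h2]
    omega

/-! Catabolizability and chain families. -/

theorem Knuth.lab_eq {u v : List ℕ} (h : Knuth u v) (s : ℕ) : lab u s = lab v s := by
  induction h with
  | refl => rfl
  | symm _ ih => exact ih.symm
  | trans _ _ ih ih' => exact ih.trans ih'
  | @bac xs ys a b c hab hbc => simpa using (lab_swap (xs := xs ++ [b]) (ys := ys) hab hbc s).symm
  | acb xs ys hab hbc => exact (lab_swap hab hbc s).symm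

theorem isSplit_of_hasSmallest {s e m : ℕ} {r : List ℕ} {rs : List (List ℕ)}
    (hT : IsTableau (r :: rs)) (hw : IsWord s e (rowword (r :: rs))) (hm : 0 < m)
    (h : HasSmallestInFirstRow m (r :: rs)) :
    IsSplit s e (rowword rs) (r.take m) (r.drop m) where
  word := by rwa [List.take_append_drop, ← rowword_cons]
  pairwise := hT.1.sublist (List.take_sublist _ _)
  lt a ha v hv := h.2 a ha v (by simpa [mem_rowword] using hv)
  ne_nil := by
    intro h0
    have h1 : (r.take m).length = m := List.length_take_of_le h.1
    rw [h0, List.length_nil] at h1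
    omega

theorem rowword_cons_eq (m : ℕ) (r : List ℕ) (rs : List (List ℕ)) :
    rowword (r :: rs) = rowword rs ++ (r.take m ++ r.drop m) := by
  rw [List.take_append_drop, rowword_cons]

theorem forall_length_le_of_map_eq {F G : List (List ℕ)} {k : ℕ}
    (h : G.map List.length = F.map List.length) (hk : ∀ c ∈ F, c.length ≤ k) :
    ∀ c ∈ G, c.length ≤ k := by
  intro c hc
  have := List.mem_map_of_mem (f := List.length) hc
  rw [h] at this
  obtain ⟨d, hd, hdc⟩ := List.mem_map.mp this
  exact hdc ▸ hk d hd

theorem length_flatten_of_map_eq {F G : List (List ℕ)}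
    (h : G.map List.length = F.map List.length) : G.flatten.length = F.flatten.length := by
  rw [List.length_flatten, List.length_flatten, h]

/-- A catabolism of type `μ` gives chain families of the sizes `μ_1 + ⋯ + μ_k`. -/
theorem exists_isFamily_of_catabolizable {μ : List ℕ} (hμ : μ.Pairwise (· ≥ ·))
    (hpos : ∀ i ∈ μ, 0 < i) {u : List ℕ} {s e : ℕ} (hu : IsWord s e u)
    (h : CatabolizableList (insertionTableau u) μ) (k : ℕ) :
    ∃ F, IsFamily u s F ∧ F.length ≤ μ.headD 0 ∧ (∀ c ∈ F, c.length ≤ k) ∧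
      F.flatten.length = (μ.take k).sum := by
  have hnil : ∀ u s, IsFamily u s [] := fun u s => ⟨by simp, by simp, by simp, by simp⟩
  induction μ generalizing u s k with
  | nil => exact ⟨[], hnil u s, by simp, by simp, by simp⟩
  | cons m μ ih =>
    cases k with
    | zero => exact ⟨[], hnil u s, by simp, by simp, by simp⟩
    | succ k =>
      obtain ⟨hT, hk⟩ := isTableau_insertionTableau hu.nodup
      have hm := hpos m (by simp)
      rcases hTu : insertionTableau u with _ | ⟨r, rs⟩
      · rw [hTu] at h
        exact absurd h.1 hm.ne'
      · rw [hTu] at h hT hk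
        have hs := isSplit_of_hasSmallest hT (hu.perm hk.perm) hm h.1
        have hlen : (r.take m).length = m := List.length_take_of_le h.1.1
        obtain ⟨F, hF, hFm, hFk, hFs⟩ := ih (List.pairwise_cons.mp hμ).2
          (fun i hi => hpos i (List.mem_cons_of_mem _ hi)) hs.isWord h.2 k
        -- Weak decrease of the parts ensures that there are enough letters to prolong every chain.
        have hle : μ.headD 0 ≤ m := by
          cases μ with
          | nil => simp
          | cons m' μ => exact (List.pairwise_cons.mp hμ).1 m' (by simp)
        obtain ⟨G, hG, hGl, hGk, hGs⟩ :=
          hs.exists_isFamily_of_rotate hF (by omega) hFk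
        rw [← rowword_cons_eq] at hG
        obtain ⟨H, hH, hHl⟩ := (hk.exists_isFamily hu).2 G hG
        refine ⟨H, hH, ?_, forall_length_le_of_map_eq hHl hGk, ?_⟩
        · have := congrArg List.length hHl
          simp only [List.length_map] at this
          simp only [List.headD_cons]
          omega
        · rw [length_flatten_of_map_eq hHl, hGs, hFs, hlen]
          simp

/-! ### The greedy catabolism. -/

theorem lab_ne_zero_of_mem_dropWhile {r : List ℕ} (hr : r.Pairwise (· < ·)) {f : ℕ → ℕ}
    (hf : Monotone f) {v : ℕ} (hv : v ∈ r.dropWhile (fun v => f v = 0)) : f v ≠ 0 := by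
  induction r with
  | nil => simp at hv
  | cons a r ih =>
    rw [List.pairwise_cons] at hr
    by_cases ha : f a = 0
    · rw [List.dropWhile_cons_of_pos (by simpa using ha)] at hv
      exact ih hr.2 hv
    · rw [List.dropWhile_cons_of_neg (by simpa using ha)] at hv
      rcases List.mem_cons.mp hv with rfl | hv
      · exact ha
      · have := hf (hr.1 v hv).le
        omega

theorem Over.countP_le {r s : List ℕ} (h : Over r s) (t : ℕ) :
    s.countP (· < t) ≤ r.countP (· < t) := by
  induction s generalizing r with
  | nil => simp
  | cons b s ih =>
    cases r with
    | nil => exact h.elim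
    | cons a r =>
      have := ih h.2
      have := h.1
      simp only [List.countP_cons, decide_eq_true_eq]
      split_ifs <;> omega

/-- The letters with label `0` can be removed by a catabolism. -/
theorem exists_isSplit_lab_zero {s e : ℕ} {r : List ℕ} {rs : List (List ℕ)}
    (hT : IsTableau (r :: rs)) (hw : IsWord s e (rowword (r :: rs))) (hse : s < e) :
    ∃ m, HasSmallestInFirstRow m (r :: rs) ∧ 0 < m ∧
      ∀ v ∈ rowword (r :: rs), lab (rowword (r :: rs)) s v = 0 → v ∈ r.take m := by
  set f := lab (rowword (r :: rs)) s with hf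
  have hmono : Monotone f := lab_mono _ _
  have hsr : s ∈ r := by
    have h1 := (hw.mem_iff s).2 ⟨le_rfl, hse⟩
    rw [rowword_cons, List.mem_append, mem_rowword] at h1
    refine h1.resolve_left fun h2 => ?_
    obtain ⟨a, ha, hlt⟩ := hT.exists_lt h2
    have := (hw.mem_iff a).1 (by rw [rowword_cons]; simp [ha])
    omega
  have hfs : f s = 0 := lab_of_le le_rfl
  have htw := List.takeWhile_append_dropWhile (p := fun v => f v = 0) (l := r)
  set A := r.takeWhile (fun v => f v = 0) with hA
  set x := r.dropWhile (fun v => f v = 0) with hx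
  have hA0 : ∀ v ∈ A, f v = 0 := fun v hv => by simpa using List.mem_takeWhile_imp hv
  have hx0 : ∀ v ∈ x, f v ≠ 0 := fun v hv => lab_ne_zero_of_mem_dropWhile hT.1 hmono hv
  have hy0 : ∀ v ∈ rowword rs, f v ≠ 0 := by
    intro v hv hv0
    have hvm := (hw.mem_iff v).1 (by rw [rowword_cons]; simp [hv])
    have hnd := hw.nodup
    have hne : s ≠ v := by rw [rowword_cons] at hnd; grind
    -- A letter of label 0 other than `s` stands right of `s`; but the lower rows are read before
    -- the first row, which contains `s`.
    have h1 := before_of_lab_eq hw le_rfl (by omega) hvm.2 (by rw [← hf, hfs, hv0])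
    refine h1.asymm hnd ?_
    rw [rowword_cons, before_append]
    exact .inr (.inl ⟨hv, hsr⟩)
  have htake : r.take A.length = A := by
    conv_lhs => rw [← htw]
    exact List.take_left
  have hdrop : r.drop A.length = x := by
    conv_lhs => rw [← htw]
    exact List.drop_left
  have hall : ∀ v ∈ rowword (r :: rs), f v = 0 → v ∈ A := by
    intro v hv hv0
    rw [rowword_cons, ← htw] at hv
    grind
  refine ⟨A.length, ⟨?_, ?_⟩, ?_, ?_⟩
  · rw [← htw]; simp
  · rw [htake, hdrop]
    intro a ha b hb
    by_contra hab
    have h1 := hmono (not_lt.mp hab)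
    have h2 := hA0 a ha
    rw [List.mem_append, ← mem_rowword] at hb
    rcases hb with hb | hb
    · exact hx0 b hb (by omega)
    · exact hy0 b hb (by omega)
  · have := hall s ((hw.mem_iff s).2 ⟨le_rfl, hse⟩) hfs
    exact List.length_pos_of_mem this
  · rwa [htake]

/-- The number of letters with label `0` does not increase under the greedy catabolism. -/
theorem le_of_lab_rotate_zero {s e m m' : ℕ} {r : List ℕ} {rs : List (List ℕ)}
    (hT : IsTableau (r :: rs)) (hs : IsSplit s e (rowword rs) (r.take m) (r.drop m))
    (hm : m ≤ r.length)
    (h0 : ∀ v ∈ rowword (r :: rs), lab (rowword (r :: rs)) s v = 0 → v ∈ r.take m)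
    (h : ∀ v, s + m ≤ v → v < s + m + m' → v ∈ r.drop m ++ rowword rs ∧
      lab (r.drop m ++ rowword rs) (s + m) v = 0) : m' ≤ m := by
  have hlen : (r.take m).length = m := List.length_take_of_le hm
  rw [rowword_cons_eq m] at h0
  -- Rotation keeps the labels on the rest of the first row, and no letter of label 0 remained
  -- there.
  have hx : ∀ v ∈ r.drop m, s + m + m' ≤ v := by
    intro v hv
    by_contra hlt
    have hvm := (hs.isWord.mem_iff v).1 (by simp [hv])
    have h1 := (hs.lab_eq hvm.1 hvm.2).1 hv
    rw [hlen] at h1 hvm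
    rw [(h v hvm.1 (by omega)).2] at h1
    have h2 := h0 v (List.mem_append_right _ (List.mem_append_right _ hv)) h1
    have := (hs.mem_iff v).1 h2
    omega
  rcases Nat.eq_zero_or_pos m' with rfl | hm'
  · exact Nat.zero_le _
  have hy : ∀ v, s + m ≤ v → v < s + m + m' → v ∈ rowword rs := by
    intro v h1 h2
    refine (List.mem_append.mp (h v h1 h2).1).resolve_left fun h3 => ?_
    have := hx v h3
    omega
  rcases rs with _ | ⟨r₂, rs⟩
  · simpa [rowword] using hy (s + m) le_rfl (by omega)
  have hnd := hs.isWord.nodup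
  have hyw : ∀ v ∈ rowword (r₂ :: rs), s + m ≤ v := fun v hv => by
    have := ((hs.isWord.mem_iff v).1 (by simp [hv])).1
    omega
  -- The new letters of label 0 lie below the first row. The smallest of them lies in the second row
  -- by column strictness, and the others stand to its right.
  have hr₂ : ∀ v, s + m ≤ v → v < s + m + m' → v ∈ r₂ := by
    have hsm : s + m ∈ r₂ := by
      have h1 := hy (s + m) le_rfl (by omega)
      rw [rowword_cons, List.mem_append, mem_rowword] at h1
      refine h1.resolve_left fun h2 => ?_
      obtain ⟨a, ha, hlt⟩ := hT.2.2.exists_lt h2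
      have := hyw a (by rw [rowword_cons]; simp [ha])
      omega
    intro v h1 h2
    rcases h1.eq_or_lt with rfl | hlt
    · exact hsm
    have h3 := hy v h1 h2
    rw [rowword_cons, List.mem_append] at h3
    refine h3.resolve_left fun h4 => ?_
    obtain ⟨h5, h6⟩ := h v h1 h2
    have hw := hs.isWord
    rw [hlen] at hw
    have h7 := before_of_lab_eq hw le_rfl hlt ((hw.mem_iff v).1 h5).2
      (by rw [h6, lab_of_le le_rfl])
    refine h7.asymm hnd ?_
    rw [rowword_cons, before_append, before_append]
    exact .inr (.inr (.inr (.inl ⟨h4, hsm⟩)))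
  -- Letters below the threshold `s + m + m'` are counted: at least `m'` in the second row, at most
  -- `m` in the first, while column strictness gives the first row at least as many as the second.
  have hc : m' ≤ r₂.countP (· < s + m + m') := by
    rw [List.countP_eq_length_filter]
    have hsp : (List.range' (s + m) m').Subperm (r₂.filter (· < s + m + m')) := by
      refine (List.nodup_range' ..).subperm fun v hv => ?_
      rw [List.mem_range'_1] at hv
      simpa using ⟨hr₂ v hv.1 hv.2, hv.2⟩
    simpa using hsp.length_le
  have hc' : r.countP (· < s + m + m') ≤ m := by
    conv_lhs => rw [← List.take_append_drop m r]
    rw [List.countP_append, (List.countP_eq_zero (l := r.drop m)).mpr, add_zero]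
    · exact List.countP_le_length.trans hlen.le
    · intro v hv
      have := hx v hv
      simpa using this
  exact hc.trans ((hT.2.1.countP_le _).trans hc')

/-- The greedy catabolism bounds the sizes of chain families. -/
theorem exists_catabolizable {u : List ℕ} {s e : ℕ} (hu : IsWord s e u) :
    ∃ μ : List ℕ, μ.Pairwise (· ≥ ·) ∧ (∀ i ∈ μ, 0 < i) ∧ μ.sum = u.length ∧
      CatabolizableList (insertionTableau u) μ ∧
      (∀ v, s ≤ v → v < s + μ.headD 0 → v ∈ u ∧ lab u s v = 0) ∧
      ∀ k F, IsFamily u s F → (∀ c ∈ F, c.length ≤ k) → F.flatten.length ≤ (μ.take k).sum := by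
  -- The clause on labels in the conclusion is what `le_of_lab_rotate_zero` needs to compare the
  -- next part with the new one.
  induction hN : u.length using Nat.strong_induction_on generalizing u s with
  | _ N ih =>
  obtain ⟨hT, hk⟩ := isTableau_insertionTableau hu.nodup
  rcases hTu : insertionTableau u with _ | ⟨r, rs⟩
  · rw [hTu] at hk
    obtain rfl : u = [] := List.Perm.eq_nil hk.perm
    refine ⟨[], by simp, by simp, by simpa using hN, rfl, by simp, ?_⟩
    intro k F hF _
    rw [List.eq_nil_of_subset_nil hF.subset]
    simp
  · rw [hTu] at hT hk
    have hw := hu.perm hk.perm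
    have hse : s < e := by
      by_contra hse
      have hnil : u = [] := List.eq_nil_iff_forall_not_mem.mpr fun v hv => by
        have := (hu.mem_iff v).1 hv
        omega
      rw [hnil] at hTu
      simp [insertionTableau] at hTu
    obtain ⟨m, hm, hm0, hz⟩ := exists_isSplit_lab_zero hT hw hse
    have hs := isSplit_of_hasSmallest hT hw hm0 hm
    have hlen : (r.take m).length = m := List.length_take_of_le hm.1
    have hul : u.length = m + (r.drop m ++ rowword rs).length := by
      have h1 := hk.perm.length_eq
      rw [rowword_cons_eq m, List.length_append, List.length_append, hlen] at h1
      rw [List.length_append]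
      omega
    obtain ⟨μ, hμ, hpos, hsum, hcat, hhd, hfam⟩ := ih _ (by omega) hs.isWord rfl
    rw [hlen] at hhd
    have hle := le_of_lab_rotate_zero hT hs hm.1 hz hhd
    refine ⟨m :: μ, ?_, ?_, ?_, ⟨hm, hcat⟩, ?_, ?_⟩
    · refine List.pairwise_cons.mpr ⟨fun a ha => ?_, hμ⟩
      cases μ with
      | nil => simp at ha
      | cons m' μ =>
        refine le_trans ?_ hle
        rcases List.mem_cons.mp ha with rfl | ha
        · exact le_rfl
        · exact (List.pairwise_cons.mp hμ).1 a ha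
    · intro i hi
      rcases List.mem_cons.mp hi with rfl | hi
      · exact hm0
      · exact hpos i hi
    · rw [List.sum_cons, hsum, ← hN, hul]
    · intro v h1 h2
      have h3 := (hs.mem_iff v).2 ⟨h1, by rw [hlen]; exact h2⟩
      refine ⟨hk.perm.mem_iff.mpr ?_, ?_⟩
      · rw [rowword_cons_eq m]
        exact List.mem_append_right _ (List.mem_append_left _ h3)
      · rw [hk.lab_eq, rowword_cons_eq m]
        exact hs.lab_eq_zero (by rw [hlen]; exact h2)
    · intro k F hF hFk
      cases k with
      | zero =>
        have : F.flatten = [] := by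
          rw [List.flatten_eq_nil_iff]
          intro c hc
          exact List.eq_nil_of_length_eq_zero (Nat.le_zero.mp (hFk c hc))
        simp [this]
      | succ k =>
        obtain ⟨G, hG, hGl⟩ := (hk.exists_isFamily hu).1 F hF
        rw [rowword_cons_eq m] at hG hz
        obtain ⟨H, hH, hHk, hHs⟩ := hs.exists_isFamily_rotate hz hG
          (forall_length_le_of_map_eq hGl hFk)
        have := hfam k H hH hHk
        rw [length_flatten_of_map_eq hGl, hlen] at hHs
        rw [List.take_succ_cons, List.sum_cons]
        omega

/-! Chains of the periodic extension as chains of letters. -/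

theorem before_getElem {l : List ℕ} {i j : ℕ} (hij : i < j) (hj : j < l.length) :
    Before l (l[i]'(hij.trans hj)) l[j] := by
  induction l generalizing i j with
  | nil => simp at hj
  | cons x l ih =>
    obtain ⟨j, rfl⟩ := Nat.exists_eq_succ_of_ne_zero (by omega : j ≠ 0)
    cases i with
    | zero => exact .inl ⟨rfl, by simp⟩
    | succ i =>
      simp only [List.getElem_cons_succ]
      exact .inr (ih (by omega) (by simpa using hj))

section

variable {n : ℕ} (w : Equiv.Perm (Fin n))

theorem isWord_toWord : IsWord 1 (n + 1) (toWord w) := by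
  constructor
  · rw [toWord, List.nodup_ofFn]
    intro p q h
    simpa [Fin.val_inj] using h
  · intro v
    rw [toWord, List.mem_ofFn]
    constructor
    · rintro ⟨p, rfl⟩
      have := (w p).isLt
      omega
    · rintro ⟨h1, h2⟩
      refine ⟨w.symm ⟨v - 1, by omega⟩, ?_⟩
      simp only [Equiv.apply_symm_apply]
      omega

theorem before_toWord {p q : Fin n} :
    Before (toWord w) ((w p : ℕ) + 1) ((w q : ℕ) + 1) ↔ p < q := by
  have key : ∀ {p q : Fin n}, p < q → Before (toWord w) ((w p : ℕ) + 1) ((w q : ℕ) + 1) := by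
    intro p q hpq
    have := before_getElem (l := toWord w) (i := p) (j := q) hpq (by simp [toWord])
    simpa [toWord] using this
  refine ⟨fun h => ?_, key⟩
  by_contra hpq
  rcases (not_lt.mp hpq).eq_or_lt with rfl | hlt
  · exact h.asymm (isWord_toWord w).nodup h
  · exact h.asymm (isWord_toWord w).nodup (key hlt)

theorem lab_toWord (v : ℕ) (h : v < n) : lab (toWord w) 1 (v + 1) = letterLabel w v h := by
  induction v with
  | zero => exact lab_of_le le_rfl
  | succ v ih =>
    have hb := before_toWord w (p := w.symm ⟨v + 1, h⟩) (q := w.symm ⟨v, Nat.lt_of_succ_lt h⟩)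
    simp only [Equiv.apply_symm_apply] at hb
    rw [letterLabel, ← ih (Nat.lt_of_succ_lt h)]
    split_ifs with hlt
    · exact lab_succ_of_before (by omega) (hb.2 hlt)
    · exact lab_succ_of_not_before (by omega) (mt hb.1 hlt)

theorem lab_toWord_apply (p : Fin n) :
    lab (toWord w) 1 ((w p : ℕ) + 1) = cochargeLabeling w p :=
  lab_toWord w _ _

end

variable {n : ℕ} [NeZero n] (w : Equiv.Perm (Fin n))

/-- The letter at the position congruent to `i`. -/
def letterAt (i : Set.Iic (n : ℤ)) : ℕ :=
  (w ⟨(((i : ℤ) - 1) % (n : ℤ)).toNat, emod_toNat_lt _⟩ : ℕ) + 1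

theorem letterAt_eq_iff {i j : Set.Iic (n : ℤ)} : letterAt w i = letterAt w j ↔ rsd i = rsd j := by
  have hn : (n : ℤ) ≠ 0 := by exact_mod_cast NeZero.ne n
  have h1 := Int.emod_nonneg ((i : ℤ) - 1) hn
  have h2 := Int.emod_nonneg ((j : ℤ) - 1) hn
  rw [letterAt, letterAt, rsd, rsd, add_left_inj, Fin.val_inj, w.apply_eq_iff_eq, Fin.mk.injEq,
    ← Nat.cast_inj (R := ℤ), Int.toNat_of_nonneg h1, Int.toNat_of_nonneg h2,
    ZMod.intCast_eq_intCast_iff]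
  exact ⟨fun h => by simpa using Int.ModEq.add_right 1 h, fun h => Int.ModEq.sub_right 1 h⟩

theorem exists_eq_sub_mul (i : Set.Iic (n : ℤ)) :
    ∃ (p : Fin n) (d : ℕ), (i : ℤ) = p + 1 - d * n ∧ letterAt w i = (w p : ℕ) + 1 ∧
      periodicExt w i = cochargeLabeling w p + d := by
  have hn : (0 : ℤ) < n := by exact_mod_cast Nat.pos_of_ne_zero (NeZero.ne n)
  have hi : (i : ℤ) ≤ n := i.2
  have h1 := Int.emod_nonneg ((i : ℤ) - 1) hn.ne'
  have h2 : ((i : ℤ) - 1) / n ≤ 0 := by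
    have := Int.ediv_lt_of_lt_mul hn (a := (i : ℤ) - 1) (b := 1) (by omega)
    omega
  refine ⟨⟨(((i : ℤ) - 1) % (n : ℤ)).toNat, emod_toNat_lt _⟩, (-(((i : ℤ) - 1) / (n : ℤ))).toNat,
    ?_, rfl, rfl⟩
  have := Int.emod_add_mul_ediv ((i : ℤ) - 1) n
  simp only [Int.toNat_of_nonneg h1, Int.toNat_of_nonneg (neg_nonneg.mpr h2)]
  linarith

theorem letterAt_eq {i : Set.Iic (n : ℤ)} {p : Fin n} {d : ℤ} (h : (i : ℤ) = p + 1 + n * d) :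
    letterAt w i = (w p : ℕ) + 1 := by
  have : (((i : ℤ) - 1) % (n : ℤ)).toNat = p := by
    rw [h, add_right_comm, add_sub_cancel_right, Int.add_mul_emod_self_left,
      Int.emod_eq_of_lt (by positivity) (by exact_mod_cast p.isLt)]
    simp
  simp [letterAt, this]

theorem arc_letterAt {i j : Set.Iic (n : ℤ)} (hlt : j < i)
    (h : periodicExt w j = periodicExt w i + 1) :
    Arc (toWord w) 1 (letterAt w i) (letterAt w j) := by
  obtain ⟨p, d, hi, hl, hp⟩ := exists_eq_sub_mul w i
  obtain ⟨q, d', hj, hl', hq⟩ := exists_eq_sub_mul w j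
  have hlt' : (j : ℤ) < i := hlt
  rw [Arc, hl, hl', lab_toWord_apply, lab_toWord_apply, before_toWord]
  rw [hp, hq] at h
  have hpn := p.isLt
  have hqn := q.isLt
  -- Here `d` and `d'` count the periods to the left of the window. The case `d' < d` would place
  -- `j` to the right of `i`, and `d' = d` compares positions in one window; in the last case the
  -- label does not rise.
  rcases lt_trichotomy d' d with hd | rfl | hd
  · exfalso
    have : ((d' : ℤ) + 1) * n ≤ d * n := by
      gcongr
      exact_mod_cast hd
    rw [add_mul] at this
    omega
  · right
    refine ⟨by omega, ?_⟩
    rw [Fin.lt_def]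
    omega
  · left
    omega

/-- The letters of a chain. -/
def Chain.letters {w : Equiv.Perm (Fin n)} (A : Chain w) : List ℕ :=
  List.ofFn fun i => letterAt w (A.idx i)

namespace Chain

variable {w}

theorem mem_letters {A : Chain w} {v : ℕ} : v ∈ A.letters ↔ ∃ i, letterAt w (A.idx i) = v := by
  rw [letters, List.mem_ofFn]

theorem length_letters (A : Chain w) : A.letters.length = A.length := by
  simp [letters, length]

theorem card_underlying (A : Chain w) : A.underlying.card = A.length := by
  rw [underlying, Finset.card_image_of_injective _ A.strictAnti.injective, Finset.card_univ,
    Fintype.card_fin, length]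

theorem nodup_letters (A : Chain w) : A.letters.Nodup := by
  rw [letters, List.nodup_ofFn]
  intro i j hij
  by_contra hne
  exact A.rsd_ne i j hne ((letterAt_eq_iff w).1 hij)

theorem isChain_letters (A : Chain w) : A.letters.IsChain (Arc (toWord w) 1) := by
  rw [List.isChain_iff_getElem]
  intro i hi
  rw [length_letters, length] at hi
  simp only [letters, List.getElem_ofFn]
  refine arc_letterAt w (A.strictAnti ?_) ?_
  · simp [Fin.lt_def]
  · rw [A.value_eq, A.value_eq]

theorem disjoint_residues_iff {A B : Chain w} :
    Disjoint A.residues B.residues ↔ A.letters.Disjoint B.letters := by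
  simp only [Finset.disjoint_left, List.Disjoint, residues, underlying, mem_letters,
    Finset.mem_image, Finset.mem_univ, true_and, exists_exists_eq_and]
  constructor
  · rintro h _ ⟨i, rfl⟩ ⟨j, hj⟩
    exact h ⟨i, rfl⟩ ⟨j, (letterAt_eq_iff w).1 hj⟩
  · rintro h _ ⟨i, rfl⟩ ⟨j, hj⟩
    exact h ⟨i, rfl⟩ ⟨j, (letterAt_eq_iff w).2 hj⟩

end Chain

/-! ### Translation of chain families in both directions. -/

theorem isFamily_letters {F : Finset (Chain w)} {k : ℕ} (hF : IsBoundedChainFamily k F) :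
    IsFamily (toWord w) 1 (F.toList.map Chain.letters) where
  chain c hc := by
    obtain ⟨A, -, rfl⟩ := List.mem_map.mp hc
    exact A.isChain_letters
  head c hc v hv := by
    obtain ⟨A, -, rfl⟩ := List.mem_map.mp hc
    obtain rfl : letterAt w (A.idx 0) = v := by simpa [Chain.letters, List.ofFn_succ] using hv
    obtain ⟨p, d, -, hl, hp⟩ := exists_eq_sub_mul w (A.idx 0)
    have := A.value_eq 0
    rw [hl, lab_toWord_apply]
    simp only [Fin.val_zero] at this
    omega
  nodup := by
    rw [List.nodup_flatten]
    constructor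
    · intro c hc
      obtain ⟨A, -, rfl⟩ := List.mem_map.mp hc
      exact A.nodup_letters
    · rw [List.pairwise_map]
      exact F.nodup_toList.pairwise_of_forall_ne fun A hA B hB hne =>
        Chain.disjoint_residues_iff.1
          (hF.2 A (Finset.mem_toList.mp hA) B (Finset.mem_toList.mp hB) hne)
  subset := by
    intro v hv
    obtain ⟨c, hc, hv⟩ := List.mem_flatten.mp hv
    obtain ⟨A, -, rfl⟩ := List.mem_map.mp hc
    obtain ⟨i, rfl⟩ := Chain.mem_letters.mp hv
    rw [(isWord_toWord w).mem_iff, letterAt]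
    omega

theorem card_support_le_length (F : Finset (Chain w)) :
    (support F).card ≤ (F.toList.map Chain.letters).flatten.length := by
  -- The inequality suffices, since this direction only serves the upper bound on families.
  refine Finset.card_biUnion_le.trans_eq ?_
  rw [List.length_flatten, List.map_map, Finset.sum_map_toList]
  exact Finset.sum_congr rfl fun A _ => by
    rw [A.card_underlying, Function.comp_apply, A.length_letters]

theorem exists_letters_eq {c : List ℕ} (hne : c ≠ []) (hc : c.IsChain (Arc (toWord w) 1))
    (h0 : ∀ v ∈ c.head?, lab (toWord w) 1 v = 0) (hnd : c.Nodup) (hs : c ⊆ toWord w) :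
    ∃ A : Chain w, A.letters = c := by
  obtain ⟨a, t, rfl⟩ := List.exists_cons_of_ne_nil hne
  have hpos : ∀ i : Fin (t.length + 1), ∃ p : Fin n, (w p : ℕ) + 1 = (a :: t)[i] := fun i => by
    have h := hs (List.getElem_mem i.isLt)
    rwa [toWord, List.mem_ofFn] at h
  choose p hp using hpos
  have harc : ∀ (i : ℕ) (h : i < t.length),
      Arc (toWord w) 1 ((w (p ⟨i, by omega⟩) : ℕ) + 1) ((w (p ⟨i + 1, by omega⟩) : ℕ) + 1) := by
    intro i h
    rw [hp, hp]
    exact List.isChain_iff_getElem.1 hc i (by simpa using h)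
  simp only [Arc, lab_toWord_apply, before_toWord] at harc
  -- Labels start at 0 and rise by at most one per step, so the number of periods `i - z` by which a
  -- letter is shifted is nonnegative.
  have hz : ∀ (i : ℕ) (h : i < t.length + 1), cochargeLabeling w (p ⟨i, h⟩) ≤ i := by
    intro i
    induction i with
    | zero =>
      intro h
      rw [← lab_toWord_apply, hp, h0 _ (by simp)]
    | succ i ih =>
      intro h
      have h1 := ih (by omega)
      have h2 := harc i (by omega)
      omega
  have hn : (0 : ℤ) < n := by exact_mod_cast Nat.pos_of_ne_zero (NeZero.ne n)
  let idx : Fin (t.length + 1) → Set.Iic (n : ℤ) := fun i =>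
    ⟨(p i : ℕ) + 1 + n * ((cochargeLabeling w (p i) : ℤ) - (i : ℕ)), by
      have h1 : ((cochargeLabeling w (p i) : ℤ) - (i : ℕ)) ≤ 0 := by
        have := hz i i.isLt
        simp only [Fin.eta] at this
        omega
      have h2 := mul_nonpos_of_nonneg_of_nonpos hn.le h1
      have h3 := (p i).isLt
      simp only [Set.mem_Iic]
      omega⟩
  have hl : ∀ i, letterAt w (idx i) = (a :: t)[i] := fun i => by
    rw [← hp]
    exact letterAt_eq w rfl
  refine ⟨⟨t.length, idx, ?_, ?_, ?_⟩, ?_⟩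
  · rw [Fin.strictAnti_iff_succ_lt]
    intro i
    have h1 := harc i i.isLt
    have h2 := (p i.castSucc).isLt
    have h3 := (p i.succ).isLt
    change ((p i.succ : ℕ) : ℤ) + 1 + n * ((cochargeLabeling w (p i.succ) : ℤ) - (i.succ : ℕ)) <
      (p i.castSucc : ℕ) + 1 + n * ((cochargeLabeling w (p i.castSucc) : ℤ) - (i.castSucc : ℕ))
    change cochargeLabeling w (p i.succ) ≤ cochargeLabeling w (p i.castSucc) ∨
      cochargeLabeling w (p i.succ) = cochargeLabeling w (p i.castSucc) + 1 ∧
        p i.succ < p i.castSucc at h1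
    simp only [Fin.val_succ, Fin.val_castSucc, Nat.cast_add, Nat.cast_one]
    -- If the label does not rise, the shift grows by at least a full period, which exceeds any
    -- difference of positions within the window.
    rcases h1 with h1 | ⟨h1, h4⟩
    · have h5 : (n : ℤ) * cochargeLabeling w (p i.succ) ≤ n * cochargeLabeling w (p i.castSucc) := by
        gcongr
      have h6 : ((p i.succ : ℕ) : ℤ) < n := by exact_mod_cast h3
      have h7 : (0 : ℤ) ≤ (p i.castSucc : ℕ) := by positivity
      linarith
    · rw [h1]
      rw [Fin.lt_def] at h4
      push_cast
      have h5 : ((p i.succ : ℕ) : ℤ) < (p i.castSucc : ℕ) := by exact_mod_cast h4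
      linarith
  · intro i
    have := hz i i.isLt
    rw [periodicExt_eq w (idx i) (i - cochargeLabeling w (p i)) (p i)]
    · simp only [Fin.eta] at this
      omega
    · simp only [Fin.eta] at this
      push_cast [idx, this]
      ring
  · intro i j hij h
    rw [← letterAt_eq_iff w, hl, hl] at h
    exact hij (Fin.ext ((hnd.getElem_inj_iff).1 h))
  · refine List.ext_getElem (by simp [Chain.letters]) fun i h1 h2 => ?_
    simp only [Chain.letters, List.getElem_ofFn]
    exact hl _

/-- Empty chains of letters are dropped, as a `Chain` has positive length. The last clause transfers
disjointness from the letters to the residues during the induction. -/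
theorem exists_isBoundedChainFamily {G : List (List ℕ)} {k : ℕ} (hG : IsFamily (toWord w) 1 G)
    (hk : ∀ c ∈ G, c.length ≤ k) :
    ∃ F : Finset (Chain w), IsBoundedChainFamily k F ∧ (support F).card = G.flatten.length ∧
      ∀ A ∈ F, A.letters ∈ G := by
  classical
  induction G with
  | nil => exact ⟨∅, ⟨by simp, by simp⟩, by simp [support], by simp⟩
  | cons c G ih =>
    have hnd := List.nodup_append.mp (show (c ++ G.flatten).Nodup from hG.nodup)
    have hsub : c ++ G.flatten ⊆ toWord w := hG.subset
    obtain ⟨F, hF, hFs, hFG⟩ := ih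
      ⟨fun d hd => hG.chain d (List.mem_cons_of_mem _ hd),
        fun d hd => hG.head d (List.mem_cons_of_mem _ hd), hnd.2.1,
        fun v hv => hsub (List.mem_append_right _ hv)⟩
      (fun d hd => hk d (List.mem_cons_of_mem _ hd))
    rcases eq_or_ne c [] with rfl | hne
    · exact ⟨F, hF, by simpa using hFs, fun A hA => List.mem_cons_of_mem _ (hFG A hA)⟩
    · obtain ⟨A, rfl⟩ := exists_letters_eq w hne (hG.chain c (by simp)) (hG.head c (by simp)) hnd.1
        (fun v hv => hsub (List.mem_append_left _ hv))
      have hdis : ∀ B ∈ F, Disjoint A.residues B.residues := fun B hB =>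
        Chain.disjoint_residues_iff.2 fun v hv hv' =>
          hnd.2.2 v hv v (List.mem_flatten.mpr ⟨_, hFG B hB, hv'⟩) rfl
      have hdis' : Disjoint A.underlying (support F) := by
        rw [support, Finset.disjoint_biUnion_right]
        intro B hB
        rw [Finset.disjoint_left]
        intro x hx hx'
        exact Finset.disjoint_left.mp (hdis B hB) (Finset.mem_image_of_mem rsd hx)
          (Finset.mem_image_of_mem rsd hx')
      refine ⟨insert A F, ⟨?_, ?_⟩, ?_, ?_⟩
      · intro B hB
        rcases Finset.mem_insert.mp hB with rfl | hB
        · rw [← B.length_letters]; exact hk _ (by simp)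
        · exact hF.1 B hB
      · intro B hB C hC hBC
        rcases Finset.mem_insert.mp hB with rfl | hB' <;>
          rcases Finset.mem_insert.mp hC with rfl | hC'
        · exact absurd rfl hBC
        · exact hdis C hC'
        · exact (hdis B hB').symm
        · exact hF.2 B hB' C hC' hBC
      · rw [support, Finset.biUnion_insert, ← support, Finset.card_union_of_disjoint hdis', hFs,
          A.card_underlying, List.flatten_cons, List.length_append, A.length_letters]
      · intro B hB
        rcases Finset.mem_insert.mp hB with rfl | hB
        · simp
        · exact List.mem_cons_of_mem _ (hFG B hB)

/-! The main theorem. -/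

theorem sortedParts_pairwise {n : ℕ} (lam : n.Partition) : (sortedParts lam).Pairwise (· ≥ ·) :=
  Multiset.pairwise_sort _ _

theorem pos_of_mem_sortedParts {n : ℕ} {lam : n.Partition} {i : ℕ} (h : i ∈ sortedParts lam) : 0 < i :=
  lam.parts_pos (by simpa [sortedParts] using h)

theorem partialSum_le_maxFamilySize {lam : n.Partition}
    (h : IsCatabolizable (insertionTableau (toWord w)) lam) (k : ℕ) :
    partialSum lam k ≤ maxFamilySize w k := by
  obtain ⟨G, hG, -, hk, hs⟩ := exists_isFamily_of_catabolizable (sortedParts_pairwise lam)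
    (fun i hi => pos_of_mem_sortedParts hi) (isWord_toWord w) h k
  obtain ⟨F, hF, hFs, -⟩ := exists_isBoundedChainFamily w hG hk
  exact (isGreatest_maxFamilySize w k).2 ⟨F, hF, by rw [hFs, hs, partialSum]⟩

/-- The greedy type is a witness: its partial sums bound every family from above, and families of
these sizes exist as for any catabolism. -/
theorem exists_isCatabolizable_partialSum_eq :
    ∃ lam : n.Partition, IsCatabolizable (insertionTableau (toWord w)) lam ∧
      ∀ k, partialSum lam k = maxFamilySize w k := by
  obtain ⟨μ, hμ, hpos, hsum, hcat, -, hfam⟩ := exists_catabolizable (isWord_toWord w)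
  let lam : n.Partition := ⟨(μ : Multiset ℕ), fun {i} hi => hpos i (by simpa using hi), by
    simpa [toWord] using hsum⟩
  have hlam : sortedParts lam = μ := by
    have h : ((sortedParts lam : List ℕ) : Multiset ℕ) = μ := Multiset.sort_eq _ _
    exact (Multiset.coe_eq_coe.mp h).eq_of_pairwise
      (fun a b _ _ h1 h2 => le_antisymm h2 h1) (sortedParts_pairwise lam) hμ
  have hlam' : IsCatabolizable (insertionTableau (toWord w)) lam := by
    rw [IsCatabolizable, hlam]; exact hcat
  refine ⟨lam, hlam', fun k => le_antisymm (partialSum_le_maxFamilySize w hlam' k) ?_⟩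
  obtain ⟨F, hF, hFs⟩ := (isGreatest_maxFamilySize w k).1
  rw [← hFs, partialSum, hlam]
  refine (card_support_le_length w F).trans (hfam k _ (isFamily_letters w hF) ?_)
  intro c hc
  obtain ⟨A, hA, rfl⟩ := List.mem_map.mp hc
  rw [A.length_letters]
  exact hF.1 A (Finset.mem_toList.mp hA)

end Catabolism

theorem mainTheorem3 (n : ℕ) [NeZero n] (w : Equiv.Perm (Fin n)) :
    Catabolism.IsCtype (Catabolism.insertionTableau (Catabolism.toWord w)) (Catabolism.ctype w) ∧
      ∀ k : ℕ, Catabolism.partialSum (Catabolism.ctype w) k = Catabolism.maxFamilySize w k := by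
  obtain ⟨lam, hcat, hlam⟩ := Catabolism.exists_isCatabolizable_partialSum_eq w
  have h : Catabolism.IsCtype (Catabolism.insertionTableau (Catabolism.toWord w)) lam :=
    ⟨hcat, fun mu hmu k => by
      rw [hlam]; exact Catabolism.partialSum_le_maxFamilySize w hmu k⟩
  have hc : Catabolism.IsCtype (Catabolism.insertionTableau (Catabolism.toWord w))
      (Catabolism.ctype w) := Classical.epsilon_spec ⟨lam, h⟩
  -- The partial sums of `ctype w` are at most `I_k` by catabolizability, and at least those of
  -- `lam` because `ctype w` is the greatest type.
  refine ⟨hc, fun k => le_antisymm (Catabolism.partialSum_le_maxFamilySize w hc.1 k) ?_⟩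
  rw [← hlam]
  exact hc.2 lam hcat k
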